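/- **Setting.** Let $I\subset\mathbb R$ be an interval of length $1$, $m$ Lebesgue measure on $I$, $|E|=m(E)$, and $|\cdot|_r$ the norm of $L^r(m)$. Let $\mathcal P=(\mathcal P^k)_{k\ge 0}$ be a $(c_1,c_2)$-good grid of $I$, $0<c_1<c_2<1$, consisting of intervals. That is, the $\mathcal P^k$ are finite families of intervals of positive measure, no set occurring in two different levels, such that: $\mathcal P^0=\{I\}$; each $\mathcal P^k$ is pairwise disjoint and covers $I$ up to a null set; each $Q\in\mathcal P^{k+1}$ is contained in some $R\in\mathcal P^{k}$; $c_1\le |Q|/|R|\le c_2$ whenever $Q\subset R$, $Q\in\mathcal P^{k+1}$, $R\in\mathcal P^k$; and $\bigcup_k\mathcal P^k$ generates the $\sigma$-algebra of $I$ up to null sets. Write $Q\in\mathcal P$ for $Q\in\bigcup_k\mathcal P^k$, and let $M=\sup_k\sup_{Q\in\mathcal P^k}\#\{R\in\mathcal P^k: R\cap Q\ne\emptyset\}$. Let $1\le p<\infty$. **Spaces.** For $q\in[1,\infty]$ and a family $\mathcal A=(\mathcal A(Q))_{Q\in\mathcal P}$ of sets of complex functions, $\mathcal B^s_{p,q}(\mathcal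 A)=\mathcal B^s_{p,q}(I,\mathcal P,\mathcal A)$ is the set of all $g\in L^p(m)$ of the form $g=\sum_{k}\sum_{Q\in\mathcal P^k}s_Qa_Q$ with $a_Q\in\mathcal A(Q)$, $s_Q\in\mathbb C$, where the series over $k$ converges absolutely in $L^p$ and the cost $\big(\sum_k(\sum_{Q\in\mathcal P^k}|s_Q|^p)^{q/p}\big)^{1/q}$ is finite (supremum over $k$ if $q=\infty$); $|g|_{\mathcal B^s_{p,q}(\mathcal A)}$ is the infimum of the costs of all such representations. For $Q\in\mathcal P^{k_0}$, the spaces $\mathcal B^{\beta}_{p,q}(Q,\mathcal P_Q,\mathcal A)$ are defined in the same way with $I$ replaced by $Q$ and $\mathcal P$ by the induced grid $\mathcal P_Q^i=\{R\in\mathcal P^{k_0+i}:R\subset Q\}$. **Atoms.** Let $Q\in\mathcal P$ and $0<s\le\beta$. * $\mathcal A^{sz}_{s,p}(Q)$ (Souza atoms): functions $a$ that vanish outside $Q$ and are constant on $Q$, with $|a|_\infty\le|Q|^{s-1/p}$. Put $\mathcal B^s_{p,q}=\mathcal B^s_{p,q}(\mathcal A^{sz}_{s,p})$. * $\mathcal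 A^{bv}_{s,\beta,p}(Q)$ (bounded variation atoms): functions $a$ that vanish outside $Q$ with $|a|_\infty\le|Q|^{s-1/p}$ and $\sup\big(\sum_i|a(x_{i+1})-a(x_i)|^{1/\beta}\big)^{\beta}\le|Q|^{s-1/p}$, the supremum being over all finite sequences $x_0<x_1<\dots<x_n$ in the interior of $Q$. * $\mathcal A^{bs}_{s,\beta,p,q}(Q)$ (Besov atoms): functions $a\in\mathcal B^\beta_{p,q}(Q,\mathcal P_Q,\mathcal A^{sz}_{\beta,p})$ that vanish outside $Q$, with $|a|_{\mathcal B^\beta_{p,q}(Q,\mathcal P_Q,\mathcal A^{sz}_{\beta,p})}\le K_q^{-1}|Q|^{s-\beta}$, where $K_q=M^{1+1/p}\big(\sum_{k\ge0}c_2^{k\beta q}\big)^{1/q}$ (and $K_\infty=M^{1+1/p}\sup_k c_2^{k\beta}$). **Proposition.** 1. If $0<s\le\beta\le 1/p$, there is $C>0$ such that $C\,\mathcal A^{bv}_{s,\beta,p}(Q)\subset\mathcal A^{bs}_{s,\beta,p,\infty}(Q)$ for every $Q\in\mathcal P$. 2. If $0<s\le\beta<\tilde\beta\le 1/p$, there is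 $C>0$ such that $C\,\mathcal A^{bv}_{s,\tilde\beta,p}(Q)\subset\mathcal A^{bs}_{s,\beta,p,q}(Q)$ for every $Q\in\mathcal P$ and every $q\in[1,\infty]$. 3. If $0<s<\beta\le 1/p$ and $q\in[1,\infty]$, then $\mathcal B^s_{p,q}=\mathcal B^s_{p,q}(\mathcal A^{bv}_{s,\beta,p})$, and the two norms are equivalent. (In particular, if $0<s\le\beta<\tilde\beta\le1/p$, then $\mathcal B^s_{p,q}=\mathcal B^s_{p,q}(\mathcal A^{bv}_{s,\tilde\beta,p})$ with equivalent norms, and both also agree with $\mathcal B^s_{p,q}(\mathcal A^{bv}_{s,\beta,p})$ when $s<\beta$.) -/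

import Mathlib

open MeasureTheory Filter Topology
open scoped ENNReal

noncomputable section

namespace BesovGrid

variable {Ω : Type*} [MeasurableSpace Ω]

/-- The largest number of elements of one level that meet a given element of that level. -/
def gridMult (P : ℕ → Finset (Set Ω)) : ℝ≥0∞ :=
  open Classical in
  ⨆ k, ⨆ Q ∈ P k, (((P k).filter (fun R => (R ∩ Q).Nonempty)).card : ℝ≥0∞)

/-- A grid on `(Ω, m)`: a sequence of finite families of measurable sets of positive measure,
not all empty, with bounded overlap inside each level and no set occurring in two levels. -/
structure IsGrid (m : Measure Ω) (P : ℕ → Finset (Set Ω)) : Prop where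
  measurable : ∀ k, ∀ Q ∈ P k, MeasurableSet Q
  pos : ∀ k, ∀ Q ∈ P k, 0 < m Q
  nonempty : ∃ k, (P k).Nonempty
  mult : gridMult P < ∞
  ne : ∀ i j, i ≠ j → ∀ Q ∈ P i, ∀ R ∈ P j, Q ≠ R

/-- A `(c₁, c₂)`-good grid of the phase space `I`, where `m` is a measure carried by `I`.
The last field says that the grid generates the `σ`-algebra, up to sets of measure zero (the
union in `cover` is also only required to be `I` up to a set of measure zero). -/
structure IsGoodGrid (m : Measure Ω) (I : Set Ω) (P : ℕ → Finset (Set Ω)) (c₁ c₂ : ℝ) : Prop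
    extends IsGrid m P where
  c₁_pos : 0 < c₁
  c₁_lt : c₁ < c₂
  c₂_lt : c₂ < 1
  zero : P 0 = {I}
  cover : ∀ k, m (I \ ⋃ Q ∈ P k, Q) = 0
  disjoint : ∀ k, ∀ Q ∈ P k, ∀ R ∈ P k, Q ≠ R → Disjoint Q R
  nested : ∀ k, ∀ Q ∈ P (k + 1), ∃ R ∈ P k, Q ⊆ R
  ratio : ∀ k, ∀ R ∈ P k, ∀ Q ∈ P (k + 1), Q ⊆ R →
    c₁ ≤ m.real Q / m.real R ∧ m.real Q / m.real R ≤ c₂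
  generate : ∀ E, MeasurableSet E →
    ∃ F, MeasurableSet[MeasurableSpace.generateFrom (⋃ k, (P k : Set (Set Ω)))] F ∧ E =ᵐ[m] F

/-- The cost `(∑ₖ (∑_{Q ∈ Pᵏ} |c_Q|ᵖ)^{q/p})^{1/q}`, with a supremum over `k` if `q = ∞`. -/
def cost (p : ℝ) (q : ℝ≥0∞) (P : ℕ → Finset (Set Ω)) (c : Set Ω → ℂ) : ℝ≥0∞ :=
  open Classical in
  if q = ∞ then ⨆ k, (∑ Q ∈ P k, ‖c Q‖ₑ ^ p) ^ (1 / p)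
  else (∑' k, (∑ Q ∈ P k, ‖c Q‖ₑ ^ p) ^ (q.toReal / p)) ^ (1 / q.toReal)

/-- `g = ∑ₖ ∑_{Q ∈ Pᵏ} c_Q a_Q` is a representation of `g` by atoms `a_Q ∈ A Q`: the cost is
finite and the series of the level sums converges absolutely in `Lᵖ(m)`, with sum `g`. -/
structure IsRepresentation (m : Measure Ω) (P : ℕ → Finset (Set Ω))
    (A : Set Ω → Set (Ω → ℂ)) (p : ℝ) (q : ℝ≥0∞) (g : Ω → ℂ)
    (c : Set Ω → ℂ) (a : Set Ω → Ω → ℂ) : Prop where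
  atom : ∀ k, ∀ Q ∈ P k, a Q ∈ A Q
  cost_lt : cost p q P c < ∞
  abs_conv : ∑' k, (eLpNorm (fun x => ∑ Q ∈ P k, c Q * a Q x) (ENNReal.ofReal p) m) ^
    (p / max p 1) < ∞
  tendsto : Tendsto (fun N => eLpNorm
      (fun x => g x - ∑ k ∈ Finset.range N, ∑ Q ∈ P k, c Q * a Q x) (ENNReal.ofReal p) m)
    atTop (𝓝 0)

/-- The Besov-ish space of the functions in `Lᵖ(m)` that have a representation. It is a set of
functions that is invariant under almost everywhere equality. -/
def besovSpace (m : Measure Ω) (P : ℕ → Finset (Set Ω)) (A : Set Ω → Set (Ω → ℂ))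
    (p : ℝ) (q : ℝ≥0∞) : Set (Ω → ℂ) :=
  {g | MemLp g (ENNReal.ofReal p) m ∧ ∃ c a, IsRepresentation m P A p q g c a}

/-- The norm of the Besov-ish space: the infimum of the costs of all representations. -/
def besovNorm (m : Measure Ω) (P : ℕ → Finset (Set Ω)) (A : Set Ω → Set (Ω → ℂ))
    (p : ℝ) (q : ℝ≥0∞) (g : Ω → ℂ) : ℝ≥0∞ :=
  ⨅ (c : Set Ω → ℂ) (a : Set Ω → Ω → ℂ) (_ : IsRepresentation m P A p q g c a), cost p q P c

/-- The `(s, p)`-Souza atoms on `Q`: constant on `Q`, zero outside `Q`, and bounded by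
`|Q|^{s - 1/p}`. -/
def souzaAtoms (m : Measure Ω) (s p : ℝ) (Q : Set Ω) : Set (Ω → ℂ) :=
  {a | (∀ x ∉ Q, a x = 0) ∧ (∃ z : ℂ, ∀ x ∈ Q, a x = z) ∧
    eLpNorm a ∞ m ≤ ENNReal.ofReal (m.real Q ^ (s - 1 / p))}

/-- The grid induced on an element `Q` of level `k₀`. -/
def inducedGrid (P : ℕ → Finset (Set Ω)) (k₀ : ℕ) (Q : Set Ω) : ℕ → Finset (Set Ω) :=
  open Classical in
  fun i => (P (k₀ + i)).filter (fun R => R ⊆ Q)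

/-- The normalizing constant `M^{1 + 1/p} (∑ₖ c₂^{kβq})^{1/q}` of the Besov atoms, where `M` is
the overlap constant of the grid, with a supremum over `k` if `q = ∞`. -/
def besovAtomConst (P : ℕ → Finset (Set Ω)) (c₂ β p : ℝ) (q : ℝ≥0∞) : ℝ≥0∞ :=
  open Classical in
  gridMult P ^ (1 + 1 / p) *
    (if q = ∞ then ⨆ k : ℕ, ENNReal.ofReal (c₂ ^ (k * β))
    else (∑' k : ℕ, ENNReal.ofReal (c₂ ^ (k * β * q.toReal))) ^ (1 / q.toReal))

/-- The `(s, β, p, q)`-Besov atoms on an element `Q` of the grid: functions vanishing outside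
`Q` that lie in the Besov space of smoothness `β` of the measure space `Q` with the induced grid,
with norm at most `|Q|^{s - β}` divided by the normalizing constant. -/
def besovAtoms (m : Measure Ω) (P : ℕ → Finset (Set Ω)) (c₂ s β p : ℝ) (q : ℝ≥0∞)
    (Q : Set Ω) : Set (Ω → ℂ) :=
  {a | (∀ x ∉ Q, a x = 0) ∧ ∃ k₀, Q ∈ P k₀ ∧
    a ∈ besovSpace (m.restrict Q) (inducedGrid P k₀ Q) (souzaAtoms (m.restrict Q) β p) p q ∧
    besovNorm (m.restrict Q) (inducedGrid P k₀ Q) (souzaAtoms (m.restrict Q) β p) p q a ≤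
      (besovAtomConst P c₂ β p q)⁻¹ * ENNReal.ofReal (m.real Q ^ (s - β))}

/-- The `1/β`-variation `sup (∑ᵢ |a(x_{i+1}) - a(x_i)|^{1/β})^β` of `a`, the supremum being over
all finite sequences `x₀ < x₁ < ⋯ < xₙ` in `S`. -/
def powerVar (β : ℝ) (a : ℝ → ℂ) (S : Set ℝ) : ℝ≥0∞ :=
  ⨆ (n : ℕ) (x : Fin (n + 1) → ℝ) (_ : StrictMono x) (_ : ∀ i, x i ∈ S),
    (∑ i : Fin n, ‖a (x i.succ) - a (x i.castSucc)‖ₑ ^ (1 / β)) ^ β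

/-- The `(s, β, p)`-bounded variation atoms on `Q`. -/
def bvAtoms (m : Measure ℝ) (s β p : ℝ) (Q : Set ℝ) : Set (ℝ → ℂ) :=
  {a | (∀ x ∉ Q, a x = 0) ∧
    eLpNorm a ∞ m ≤ ENNReal.ofReal (m.real Q ^ (s - 1 / p)) ∧
    powerVar β a (interior Q) ≤ ENNReal.ofReal (m.real Q ^ (s - 1 / p))}

end BesovGrid

end

noncomputable section

/-! The heart of the matter is to turn a representation by bounded variation atoms into one by Souza
atoms at controlled cost. Let `G_N` be the sum of the first `N` levels. Replace `G_{k+1}` on each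
`R` of level `k` by its value at an interior point of `R`. The differences of consecutive step
functions are constant on elements of the grid, so they are multiples of Souza atoms, with
coefficients `souzaCoeff`, and their sums telescope (`partialSum_souzaCoeff`).

The coefficient at `R` compares values at two points of the parent of `R`, so a coarser level `j <
k` enters only through the oscillation of its atom on that parent. Disjoint intervals inside `Q`
have `1/β`-powers of oscillations summing to at most the variation on `Q` (`sum_osc_le_powerVar`).
Hölder's inequality, which needs `β ≤ 1/p`, and the shrinking of the grid turn this into a factor
`θ^((β-s)(k-j))` (`sum_weight_mul_rpow_le`). Thus the new level costs are dominated by a geometric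
convolution of the old ones (`levelCost_souzaCoeff_le`). If `s < β`, Young's inequality bounds the
new cost, which is the hard half of the third claim; the other half holds because Souza atoms have
zero variation.

For the first two claims the same construction is applied, in the induced grid on `Q`, to one
rescaled atom placed at level zero. The new level costs then decay like `θ^((β'-β)k)`: bounded if
`β' = β`, summable if `β' > β`. The resampled sums have the same limit because their `L^p` distance
to `G_{N+1}` is at most `(N+1) θ^(sN)` times a bound for the level costs
(`eLpNorm_partialSum_sub_le`). -/

namespace BesovGrid

/-! ### Power variation and sums of oscillations -/

/-- `r` is at most the `1/β`-variation of `a` along a chain of points of `S` ending at `y`. -/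
def ChainBound (β : ℝ) (a : ℝ → ℂ) (S : Set ℝ) (y : ℝ) (r : ℝ≥0∞) : Prop :=
  ∃ (n : ℕ) (x : Fin (n + 1) → ℝ), StrictMono x ∧ (∀ i, x i ∈ S) ∧ x (Fin.last n) = y ∧
    r ≤ ∑ i : Fin n, ‖a (x i.succ) - a (x i.castSucc)‖ₑ ^ (1 / β)

theorem ChainBound.zero {β : ℝ} {a : ℝ → ℂ} {S : Set ℝ} {y : ℝ} (hy : y ∈ S) :
    ChainBound β a S y 0 :=
  ⟨0, fun _ => y, fun i j h => absurd h (by simp [Subsingleton.elim (α := Fin 1) i j]), fun _ => hy, rfl, zero_le⟩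

theorem ChainBound.snoc {β : ℝ} (hβ : 0 < β) {a : ℝ → ℂ} {S : Set ℝ} {y z : ℝ} {r : ℝ≥0∞}
    (h : ChainBound β a S y r) (hz : z ∈ S) (hyz : y ≤ z) :
    ChainBound β a S z (r + ‖a z - a y‖ₑ ^ (1 / β)) := by
  rcases hyz.eq_or_lt with rfl | hyz
  -- A repeated point would break strict monotonicity, but its increment is zero, so the old chain
  -- serves.
  · have : (0 : ℝ≥0∞) ^ β⁻¹ = 0 := ENNReal.zero_rpow_of_pos (by positivity)
    simpa [this] using h
  obtain ⟨n, x, hx, hS, rfl, hr⟩ := h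
  refine ⟨n + 1, Fin.snoc x z, ?_, ?_, by simp, ?_⟩
  · rw [Fin.strictMono_iff_lt_succ]
    intro i
    induction i using Fin.lastCases with
    | last => simpa using hyz
    | cast i =>
      rw [Fin.snoc_castSucc, Fin.succ_castSucc, Fin.snoc_castSucc]
      exact hx (Fin.castSucc_lt_succ)
  · intro i
    induction i using Fin.lastCases with
    | last => simpa using hz
    | cast i => simpa using hS i
  · rw [Fin.sum_univ_castSucc]
    simp only [Fin.snoc_castSucc, Fin.succ_castSucc, Fin.succ_last, Fin.snoc_last]
    gcongr

theorem ChainBound.le_powerVar {β : ℝ} (hβ : 0 < β) {a : ℝ → ℂ} {S : Set ℝ} {y : ℝ} {r : ℝ≥0∞}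
    (h : ChainBound β a S y r) : r ≤ powerVar β a S ^ (1 / β) := by
  obtain ⟨n, x, hx, hS, -, hr⟩ := h
  rw [one_div, ENNReal.le_rpow_inv_iff hβ]
  refine (ENNReal.rpow_le_rpow hr hβ.le).trans ?_
  exact le_iSup₂_of_le n x (le_iSup₂_of_le hx hS le_rfl)

/-- Separated pairs can be ordered along the line and strung into one chain; the increments across
the gaps only enlarge its variation. The induction adds the pair with the largest right end. -/
theorem sum_pairs_le_powerVar {ι : Type*} {β : ℝ} (hβ : 0 < β) (a : ℝ → ℂ) (S : Set ℝ)
    (T : Finset ι) (u v : ι → ℝ) (huS : ∀ i ∈ T, u i ∈ S) (hvS : ∀ i ∈ T, v i ∈ S)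
    (huv : ∀ i ∈ T, u i ≤ v i)
    (hsep : ∀ i ∈ T, ∀ j ∈ T, i ≠ j → v i < u j ∨ v j < u i) :
    ∑ i ∈ T, ‖a (v i) - a (u i)‖ₑ ^ (1 / β) ≤ powerVar β a S ^ (1 / β) := by
  classical
  suffices h : T = ∅ ∨ ∃ j ∈ T, ChainBound β a S (v j)
      (∑ i ∈ T, ‖a (v i) - a (u i)‖ₑ ^ (1 / β)) by
    rcases h with rfl | ⟨j, -, h⟩
    · simp
    · exact h.le_powerVar hβ
  induction T using Finset.induction_on_max_value v with
  | empty => exact Or.inl rfl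
  | insert i T hi hmax ih =>
    right
    refine ⟨i, Finset.mem_insert_self _ _, ?_⟩
    have hiT := Finset.mem_insert_self i T
    have key : ChainBound β a S (u i) (∑ i ∈ T, ‖a (v i) - a (u i)‖ₑ ^ (1 / β)) := by
      rcases ih (fun i hi => huS i (Finset.mem_insert_of_mem hi))
        (fun i hi => hvS i (Finset.mem_insert_of_mem hi))
        (fun i hi => huv i (Finset.mem_insert_of_mem hi))
        (fun i hi j hj => hsep i (Finset.mem_insert_of_mem hi) j (Finset.mem_insert_of_mem hj))
        with rfl | ⟨j, hj, h⟩
      · simpa using ChainBound.zero (huS i hiT)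
      · have hji : v j < u i := by
          have hjT := Finset.mem_insert_of_mem (a := j) (b := i) hj
          rcases hsep j hjT i hiT (by rintro rfl; exact hi hj) with h | h
          · exact h
          · have := hmax j hj
            have := huv j hjT
            linarith
        -- The chain crosses the gap from `v j` to `u i`, and the increment over the gap is
        -- discarded.
        obtain ⟨n, x, hx, hS, hl, hr⟩ := h.snoc hβ (huS i hiT) hji.le
        exact ⟨n, x, hx, hS, hl, le_self_add.trans hr⟩
    rw [Finset.sum_insert hi, add_comm]
    exact key.snoc hβ (hvS i hiT) (huv i hiT)

/-- The oscillation of `a` on the interior of `R`. -/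
def osc (a : ℝ → ℂ) (R : Set ℝ) : ℝ≥0∞ :=
  ⨆ u : interior R × interior R, ‖a u.2 - a u.1‖ₑ

theorem enorm_sub_le_osc {a : ℝ → ℂ} {R : Set ℝ} {x y : ℝ} (hx : x ∈ interior R)
    (hy : y ∈ interior R) : ‖a x - a y‖ₑ ≤ osc a R :=
  le_iSup (fun u : interior R × interior R => ‖a u.2 - a u.1‖ₑ) ⟨⟨y, hy⟩, ⟨x, hx⟩⟩

/-- If neither strict inequality held, the larger of the two left ends would belong to both
intervals. -/
theorem lt_or_lt_of_disjoint {R R' : Set ℝ} (hR : R.OrdConnected) (hR' : R'.OrdConnected)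
    (hd : Disjoint R R') {u v u' v' : ℝ} (hu : u ∈ R) (hv : v ∈ R) (hu' : u' ∈ R') (hv' : v' ∈ R')
    (huv : u ≤ v) (huv' : u' ≤ v') : v < u' ∨ v' < u := by
  by_contra! h
  exact Set.disjoint_left.1 hd
    (hR.out hu hv ⟨le_max_left u u', max_le huv h.1⟩)
    (hR'.out hu' hv' ⟨le_max_right u u', max_le h.2 huv'⟩)

/-- A choice of one pair of points in each interval gives separated pairs, and the sum of the
suprema is the supremum over such choices. -/
theorem sum_osc_le_powerVar {β : ℝ} (hβ : 0 < β) (a : ℝ → ℂ) (S : Set ℝ)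
    (T : Finset (Set ℝ)) (hT : ∀ R ∈ T, R.OrdConnected) (hne : ∀ R ∈ T, (interior R).Nonempty)
    (hsub : ∀ R ∈ T, R ⊆ S)
    (hd : ∀ R ∈ T, ∀ R' ∈ T, R ≠ R' → Disjoint R R') :
    ∑ R ∈ T, osc a R ^ (1 / β) ≤ powerVar β a (interior S) ^ (1 / β) := by
  classical
  have hmono : Monotone fun x : ℝ≥0∞ => x ^ (1 / β) :=
    ENNReal.monotone_rpow_of_nonneg (by positivity)
  let X := (R : T) → interior R.1 × interior R.1
  have hX : Nonempty X := ⟨fun R => ⟨⟨_, (hne R R.2).some_mem⟩, ⟨_, (hne R R.2).some_mem⟩⟩⟩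
  have hosc : ∀ R : T, osc a R ^ (1 / β) =
      ⨆ w : X, ‖a (w R).2 - a (w R).1‖ₑ ^ (1 / β) := by
    intro R
    have : osc a R = ⨆ w : X, ‖a (w R).2 - a (w R).1‖ₑ := by
      refine le_antisymm (iSup_le fun u => ?_) (iSup_le fun w => ?_)
      · refine le_iSup_of_le (Function.update hX.some R u) ?_
        simp
      · exact enorm_sub_le_osc (w R).2.2 (w R).1.2
    rw [this]
    exact (ENNReal.orderIsoRpow (1 / β) (by positivity)).map_iSup _
  rw [← Finset.sum_coe_sort, Finset.sum_congr rfl fun R _ => hosc R, ENNReal.finsetSum_iSup]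
  · refine iSup_le fun w => ?_
    have := sum_pairs_le_powerVar hβ a (interior S) Finset.univ
      (fun R : T => min ((w R).1 : ℝ) (w R).2) (fun R => max ((w R).1 : ℝ) (w R).2) ?_ ?_ ?_ ?_
    · refine le_trans (Finset.sum_le_sum fun R _ => ?_) this
      rcases le_total ((w R).1 : ℝ) (w R).2 with h | h
      · simp [h]
      · simp only [h, min_eq_right, max_eq_left]
        rw [enorm_sub_rev]
    · intro R _
      rcases min_choice ((w R).1 : ℝ) (w R).2 with h | h <;> rw [h]
      exacts [interior_mono (hsub R R.2) (w R).1.2, interior_mono (hsub R R.2) (w R).2.2]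
    · intro R _
      rcases max_choice ((w R).1 : ℝ) (w R).2 with h | h <;> rw [h]
      exacts [interior_mono (hsub R R.2) (w R).1.2, interior_mono (hsub R R.2) (w R).2.2]
    · intro R _
      exact min_le_max
    · intro R _ R' _ hRR
      have hmin : ∀ R : T, min ((w R).1 : ℝ) (w R).2 ∈ R.1 := fun R => by
        rcases min_choice ((w R).1 : ℝ) (w R).2 with h | h <;> rw [h]
        exacts [interior_subset (w R).1.2, interior_subset (w R).2.2]
      have hmax : ∀ R : T, max ((w R).1 : ℝ) (w R).2 ∈ R.1 := fun R => by
        rcases max_choice ((w R).1 : ℝ) (w R).2 with h | h <;> rw [h]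
        exacts [interior_subset (w R).1.2, interior_subset (w R).2.2]
      exact lt_or_lt_of_disjoint (hT R R.2) (hT R' R'.2)
        (hd R R.2 R' R'.2 fun h => hRR (Subtype.ext h)) (hmin R) (hmax R) (hmin R') (hmax R')
        min_le_max min_le_max
  -- Two choices are dominated by a third that takes the better pair in each interval; this
  -- directedness lets the supremum leave the finite sum.
  · intro w w'
    refine ⟨fun R => if ‖a (w R).2 - a (w R).1‖ₑ ≤ ‖a (w' R).2 - a (w' R).1‖ₑ then w' R else w R,
      fun R => ?_⟩
    beta_reduce
    split_ifs with h
    · exact ⟨hmono h, le_rfl⟩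
    · exact ⟨le_rfl, hmono (not_le.1 h).le⟩

theorem enorm_sub_le_powerVar {β : ℝ} (hβ : 0 < β) {a : ℝ → ℂ} {S : Set ℝ} {x y : ℝ}
    (hx : x ∈ S) (hy : y ∈ S) : ‖a x - a y‖ₑ ≤ powerVar β a S := by
  wlog h : y ≤ x generalizing x y
  · rw [enorm_sub_rev]
    exact this hy hx (le_of_not_ge h)
  have := ((ChainBound.zero hy).snoc (a := a) hβ hx h).le_powerVar hβ
  rw [zero_add] at this
  exact (ENNReal.rpow_le_rpow_iff (by positivity)).1 this

theorem powerVar_eq_zero_of_const {β : ℝ} (hβ : 0 < β) {a : ℝ → ℂ} {S : Set ℝ} {z : ℂ}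
    (h : ∀ x ∈ S, a x = z) : powerVar β a S = 0 := by
  simp only [powerVar, ENNReal.iSup_eq_zero]
  intro n x _ hS
  have : (0 : ℝ≥0∞) ^ β⁻¹ = 0 := ENNReal.zero_rpow_of_pos (by positivity)
  simp [h _ (hS _), this, ENNReal.zero_rpow_of_pos hβ]

theorem powerVar_const_mul_le {β : ℝ} (hβ : 0 < β) (a : ℝ → ℂ) (S : Set ℝ) (z : ℂ) :
    powerVar β (fun x => z * a x) S ≤ ‖z‖ₑ * powerVar β a S := by
  refine iSup₂_le fun n x => iSup₂_le fun hx hS => ?_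
  have : (∑ i : Fin n, ‖z * a (x i.succ) - z * a (x i.castSucc)‖ₑ ^ (1 / β)) ^ β =
      ‖z‖ₑ * (∑ i : Fin n, ‖a (x i.succ) - a (x i.castSucc)‖ₑ ^ (1 / β)) ^ β := by
    simp only [← mul_sub, enorm_mul]
    simp_rw [ENNReal.mul_rpow_of_nonneg _ _ (show 0 ≤ 1 / β by positivity)]
    rw [← Finset.mul_sum, ENNReal.mul_rpow_of_nonneg _ _ hβ.le, ← ENNReal.rpow_mul,
      one_div_mul_cancel hβ.ne', ENNReal.rpow_one]
  rw [this]
  gcongr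
  exact le_iSup₂_of_le n x (le_iSup₂_of_le hx hS le_rfl)

/-! ### Grids of intervals: ancestors, descendants and measures -/

/-- A grid of intervals for a measure `m` carried by its zeroth level: disjoint nested levels
whose elements shrink from one level to the next by a factor between `κ` and `θ`. -/
structure IsIntervalGrid (m : Measure ℝ) (P : ℕ → Finset (Set ℝ)) (κ θ : ℝ≥0∞) : Prop where
  ac : m ≪ volume
  le_one : m Set.univ ≤ 1
  κ_ne_zero : κ ≠ 0
  θ_lt_one : θ < 1
  measurable : ∀ k, ∀ Q ∈ P k, MeasurableSet Q
  pos : ∀ k, ∀ Q ∈ P k, 0 < m Q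
  ordConnected : ∀ k, ∀ Q ∈ P k, Q.OrdConnected
  cover : ∀ k, ∀ᵐ x ∂m, ∃ Q ∈ P k, x ∈ Q
  disjoint : ∀ k, ∀ Q ∈ P k, ∀ R ∈ P k, Q ≠ R → Disjoint Q R
  nested : ∀ k, ∀ Q ∈ P (k + 1), ∃ R ∈ P k, Q ⊆ R
  level_unique : ∀ i j, ∀ Q ∈ P i, Q ∈ P j → i = j
  lower : ∀ k, ∀ R ∈ P k, ∀ Q ∈ P (k + 1), Q ⊆ R → κ * m R ≤ m Q
  upper : ∀ k, ∀ R ∈ P k, ∀ Q ∈ P (k + 1), Q ⊆ R → m Q ≤ θ * m R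

/-- A point in the interior of `R`, if there is one. -/
def innerPt (R : Set ℝ) : ℝ :=
  open Classical in if h : (interior R).Nonempty then h.some else 0

/-- The element of level `k` that contains `R`, if there is one. -/
def ancestor (P : ℕ → Finset (Set ℝ)) (k : ℕ) (R : Set ℝ) : Set ℝ :=
  open Classical in if h : ∃ S ∈ P k, R ⊆ S then h.choose else ∅

/-- The level of an element of the grid. -/
def level (P : ℕ → Finset (Set ℝ)) (R : Set ℝ) : ℕ :=
  open Classical in if h : ∃ k, R ∈ P k then h.choose else 0

/-- The elements of level `k` contained in `Q`. -/
def descendants (P : ℕ → Finset (Set ℝ)) (k : ℕ) (Q : Set ℝ) : Finset (Set ℝ) :=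
  open Classical in (P k).filter (fun R => R ⊆ Q)

theorem mem_descendants {P : ℕ → Finset (Set ℝ)} {k : ℕ} {Q R : Set ℝ} :
    R ∈ descendants P k Q ↔ R ∈ P k ∧ R ⊆ Q := by
  simp [descendants]

/-- An interval is convex, so its frontier is null. Variation is only controlled on interiors, and
this makes the loss harmless. -/
theorem ae_mem_interior_of_ordConnected {R : Set ℝ} (hR : R.OrdConnected) :
    ∀ᵐ x, x ∈ R → x ∈ interior R := by
  have h := hR.convex.addHaar_frontier volume
  rw [measure_eq_zero_iff_ae_notMem] at h
  filter_upwards [h] with x hx hxR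
  by_contra hxi
  exact hx ⟨subset_closure hxR, hxi⟩

namespace IsIntervalGrid

variable {m : Measure ℝ} {P : ℕ → Finset (Set ℝ)} {κ θ : ℝ≥0∞}

theorem measure_le_one (h : IsIntervalGrid m P κ θ) (R : Set ℝ) : m R ≤ 1 :=
  (measure_mono (Set.subset_univ R)).trans h.le_one

theorem measure_ne_top (h : IsIntervalGrid m P κ θ) (R : Set ℝ) : m R ≠ ∞ :=
  ((h.measure_le_one R).trans_lt ENNReal.one_lt_top).ne

theorem ae_interior (h : IsIntervalGrid m P κ θ) {k : ℕ} {R : Set ℝ} (hR : R ∈ P k) :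
    ∀ᵐ x ∂m, x ∈ R → x ∈ interior R :=
  h.ac.ae_le (ae_mem_interior_of_ordConnected (h.ordConnected k R hR))

theorem measure_interior (h : IsIntervalGrid m P κ θ) {k : ℕ} {R : Set ℝ} (hR : R ∈ P k) :
    m (interior R) = m R :=
  measure_congr ((h.ae_interior hR).mono fun _ hx => propext ⟨fun hi => interior_subset hi, hx⟩)

theorem interior_nonempty (h : IsIntervalGrid m P κ θ) {k : ℕ} {R : Set ℝ} (hR : R ∈ P k) :
    (interior R).Nonempty :=
  nonempty_of_measure_ne_zero (h.measure_interior hR ▸ (h.pos k R hR).ne')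

theorem innerPt_mem_interior (h : IsIntervalGrid m P κ θ) {k : ℕ} {R : Set ℝ} (hR : R ∈ P k) :
    innerPt R ∈ interior R := by
  rw [innerPt, dif_pos (h.interior_nonempty hR)]
  exact Set.Nonempty.some_mem _

theorem innerPt_mem (h : IsIntervalGrid m P κ θ) {k : ℕ} {R : Set ℝ} (hR : R ∈ P k) :
    innerPt R ∈ R :=
  interior_subset (h.innerPt_mem_interior hR)

theorem ae_mem (h : IsIntervalGrid m P κ θ) :
    ∀ᵐ x ∂m, ∀ k, ∃ R ∈ P k, x ∈ interior R := by
  rw [ae_all_iff]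
  intro k
  have : ∀ᵐ x ∂m, ∀ R ∈ P k, x ∈ R → x ∈ interior R :=
    (Finset.eventually_all _).2 fun R hR => h.ae_interior hR
  filter_upwards [this, h.cover k] with x hx ⟨R, hR, hxR⟩
  exact ⟨R, hR, hx R hR hxR⟩

theorem eq_of_mem (h : IsIntervalGrid m P κ θ) {k : ℕ} {Q R : Set ℝ} (hQ : Q ∈ P k) (hR : R ∈ P k)
    {x : ℝ} (hxQ : x ∈ Q) (hxR : x ∈ R) : Q = R := by
  by_contra hne
  exact Set.disjoint_left.1 (h.disjoint k Q hQ R hR hne) hxQ hxR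

theorem level_eq (h : IsIntervalGrid m P κ θ) {k : ℕ} {R : Set ℝ} (hR : R ∈ P k) :
    level P R = k := by
  have hk : ∃ k, R ∈ P k := ⟨k, hR⟩
  rw [level, dif_pos hk]
  exact h.level_unique _ _ R hk.choose_spec hR

theorem exists_superset (h : IsIntervalGrid m P κ θ) {j k : ℕ} (hjk : j ≤ k) {R : Set ℝ}
    (hR : R ∈ P k) : ∃ Q ∈ P j, R ⊆ Q := by
  induction k, hjk using Nat.le_induction generalizing R with
  | base => exact ⟨R, hR, subset_rfl⟩
  | succ k _ ih =>
    obtain ⟨S, hS, hRS⟩ := h.nested k R hR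
    obtain ⟨Q, hQ, hSQ⟩ := ih hS
    exact ⟨Q, hQ, hRS.trans hSQ⟩

theorem ancestor_mem (h : IsIntervalGrid m P κ θ) {j k : ℕ} (hjk : j ≤ k) {R : Set ℝ}
    (hR : R ∈ P k) : ancestor P j R ∈ P j := by
  have he := h.exists_superset hjk hR
  rw [ancestor, dif_pos he]
  exact he.choose_spec.1

theorem subset_ancestor (h : IsIntervalGrid m P κ θ) {j k : ℕ} (hjk : j ≤ k) {R : Set ℝ}
    (hR : R ∈ P k) : R ⊆ ancestor P j R := by
  have he := h.exists_superset hjk hR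
  rw [ancestor, dif_pos he]
  exact he.choose_spec.2

theorem ancestor_eq_of_mem (h : IsIntervalGrid m P κ θ) {j k : ℕ} (hjk : j ≤ k) {Q R : Set ℝ}
    (hR : R ∈ P k) (hQ : Q ∈ P j) {x : ℝ} (hxR : x ∈ R) (hxQ : x ∈ Q) : ancestor P j R = Q :=
  h.eq_of_mem (h.ancestor_mem hjk hR) hQ (h.subset_ancestor hjk hR hxR) hxQ

theorem ancestor_eq (h : IsIntervalGrid m P κ θ) {j k : ℕ} (hjk : j ≤ k) {Q R : Set ℝ}
    (hR : R ∈ P k) (hQ : Q ∈ P j) (hRQ : R ⊆ Q) : ancestor P j R = Q :=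
  h.ancestor_eq_of_mem hjk hR hQ (h.innerPt_mem hR) (hRQ (h.innerPt_mem hR))

theorem subset_of_mem (h : IsIntervalGrid m P κ θ) {j k : ℕ} (hjk : j ≤ k) {Q R : Set ℝ}
    (hR : R ∈ P k) (hQ : Q ∈ P j) {x : ℝ} (hxR : x ∈ R) (hxQ : x ∈ Q) : R ⊆ Q :=
  h.ancestor_eq_of_mem hjk hR hQ hxR hxQ ▸ h.subset_ancestor hjk hR

theorem ancestor_ancestor (h : IsIntervalGrid m P κ θ) {i j k : ℕ} (hij : i ≤ j) (hjk : j ≤ k)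
    {R : Set ℝ} (hR : R ∈ P k) : ancestor P i (ancestor P j R) = ancestor P i R :=
  h.ancestor_eq_of_mem hij (h.ancestor_mem hjk hR) (h.ancestor_mem (hij.trans hjk) hR)
    (h.subset_ancestor hjk hR (h.innerPt_mem hR))
    (h.subset_ancestor (hij.trans hjk) hR (h.innerPt_mem hR))

theorem measure_le_pow_mul (h : IsIntervalGrid m P κ θ) {j k : ℕ} (hjk : j ≤ k) {Q R : Set ℝ}
    (hR : R ∈ P k) (hQ : Q ∈ P j) (hRQ : R ⊆ Q) : m R ≤ θ ^ (k - j) * m Q := by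
  induction k, hjk using Nat.le_induction generalizing R with
  | base => simpa using measure_mono hRQ
  | succ k hjk ih =>
    obtain ⟨S, hS, hRS⟩ := h.nested k R hR
    have hSQ : S ⊆ Q := h.subset_of_mem hjk hS hQ (hRS (h.innerPt_mem hR)) (hRQ (h.innerPt_mem hR))
    calc m R ≤ θ * m S := h.upper k S hS R hR hRS
      _ ≤ θ * (θ ^ (k - j) * m Q) := by gcongr; exact ih hS hSQ
      _ = θ ^ (k + 1 - j) * m Q := by rw [Nat.succ_sub hjk, pow_succ']; ring

theorem measure_le_pow (h : IsIntervalGrid m P κ θ) {k : ℕ} {R : Set ℝ} (hR : R ∈ P k) :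
    m R ≤ θ ^ k := by
  obtain ⟨Q, hQ, hRQ⟩ := h.exists_superset (Nat.zero_le k) hR
  calc m R ≤ θ ^ (k - 0) * m Q := h.measure_le_pow_mul (Nat.zero_le k) hR hQ hRQ
    _ ≤ θ ^ (k - 0) * 1 := by gcongr; exact h.measure_le_one Q
    _ = θ ^ k := by simp

theorem sum_descendants_measure_le (h : IsIntervalGrid m P κ θ) (k : ℕ) (Q : Set ℝ) :
    ∑ R ∈ descendants P k Q, m R ≤ m Q := by
  rw [← measure_biUnion_finset]
  · exact measure_mono (Set.iUnion₂_subset fun R hR => (mem_descendants.1 hR).2)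
  · intro R hR R' hR' hne
    exact h.disjoint k R (mem_descendants.1 hR).1 R' (mem_descendants.1 hR').1 hne
  · exact fun R hR => h.measurable k R (mem_descendants.1 hR).1

/-- The children are disjoint and each takes at least the fraction `κ` of the measure of the parent.
-/
theorem card_children_le (h : IsIntervalGrid m P κ θ) {k : ℕ} {S : Set ℝ} (hS : S ∈ P k) :
    ((descendants P (k + 1) S).card : ℝ≥0∞) ≤ κ⁻¹ := by
  rw [ENNReal.le_inv_iff_mul_le]
  have h1 : ((descendants P (k + 1) S).card : ℝ≥0∞) * κ * m S ≤ 1 * m S := by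
    calc ((descendants P (k + 1) S).card : ℝ≥0∞) * κ * m S
        = ∑ R ∈ descendants P (k + 1) S, κ * m S := by simp [mul_assoc]
      _ ≤ ∑ R ∈ descendants P (k + 1) S, m R := Finset.sum_le_sum fun R hR =>
          h.lower k S hS R (mem_descendants.1 hR).1 (mem_descendants.1 hR).2
      _ ≤ 1 * m S := by simpa using h.sum_descendants_measure_le _ _
  exact (ENNReal.mul_le_mul_iff_left (h.pos k S hS).ne' (h.measure_ne_top S)).1 h1

theorem sum_descendants_eq (h : IsIntervalGrid m P κ θ) {M : Type*} [AddCommMonoid M] {i j k : ℕ}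
    (hij : i ≤ j) (hjk : j ≤ k) {Q : Set ℝ} (hQ : Q ∈ P i) (f : Set ℝ → M) :
    ∑ R ∈ descendants P k Q, f R = ∑ S ∈ descendants P j Q, ∑ R ∈ descendants P k S, f R := by
  classical
  rw [← Finset.sum_fiberwise_of_maps_to (s := descendants P k Q) (t := descendants P j Q)
    (g := ancestor P j)]
  · refine Finset.sum_congr rfl fun S hS => Finset.sum_congr ?_ fun _ _ => rfl
    rw [mem_descendants] at hS
    ext R
    rw [Finset.mem_filter, mem_descendants, mem_descendants]
    constructor
    · rintro ⟨⟨hR, -⟩, rfl⟩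
      exact ⟨hR, h.subset_ancestor hjk hR⟩
    · rintro ⟨hR, hRS⟩
      exact ⟨⟨hR, hRS.trans hS.2⟩, h.ancestor_eq hjk hR hS.1 hRS⟩
  · intro R hR
    rw [mem_descendants] at hR ⊢
    have hx := h.innerPt_mem hR.1
    exact ⟨h.ancestor_mem hjk hR.1, h.subset_of_mem hij (h.ancestor_mem hjk hR.1) hQ
      (h.subset_ancestor hjk hR.1 hx) (hR.2 hx)⟩

theorem sum_eq_sum_descendants (h : IsIntervalGrid m P κ θ) {M : Type*} [AddCommMonoid M] {j k : ℕ}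
    (hjk : j ≤ k) (f : Set ℝ → M) :
    ∑ R ∈ P k, f R = ∑ Q ∈ P j, ∑ R ∈ descendants P k Q, f R := by
  classical
  rw [← Finset.sum_fiberwise_of_maps_to (s := P k) (t := P j) (g := ancestor P j)
    fun R hR => h.ancestor_mem hjk hR]
  refine Finset.sum_congr rfl fun S hS => Finset.sum_congr ?_ fun _ _ => rfl
  ext R
  rw [Finset.mem_filter, mem_descendants]
  constructor
  · rintro ⟨hR, rfl⟩
    exact ⟨hR, h.subset_ancestor hjk hR⟩
  · rintro ⟨hR, hRS⟩
    exact ⟨hR, h.ancestor_eq hjk hR hS hRS⟩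

/-- On an element of level `k`, a sum over level `k` of functions that vanish outside their own
element has a single term. -/
theorem sum_eq_single (h : IsIntervalGrid m P κ θ) {M : Type*} [AddCommMonoid M] {k : ℕ}
    {R : Set ℝ} (hR : R ∈ P k) {x : ℝ} (hx : x ∈ R) (f : Set ℝ → M)
    (hf : ∀ Q ∈ P k, x ∉ Q → f Q = 0) : ∑ Q ∈ P k, f Q = f R :=
  Finset.sum_eq_single_of_mem R hR fun Q hQ hne => hf Q hQ fun hxQ => hne (h.eq_of_mem hQ hR hxQ hx)

/-! ### Oscillation sums and Hölder's inequality -/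

theorem sum_osc_descendants_le (h : IsIntervalGrid m P κ θ) {β : ℝ} (hβ : 0 < β) (a : ℝ → ℂ)
    (k : ℕ) (Q : Set ℝ) :
    ∑ R ∈ descendants P k Q, osc a R ^ (1 / β) ≤ powerVar β a (interior Q) ^ (1 / β) := by
  refine sum_osc_le_powerVar hβ a Q _ ?_ ?_ ?_ ?_
  · exact fun R hR => h.ordConnected k R (mem_descendants.1 hR).1
  · exact fun R hR => h.interior_nonempty (mem_descendants.1 hR).1
  · exact fun R hR => (mem_descendants.1 hR).2
  · exact fun R hR R' hR' => h.disjoint k R (mem_descendants.1 hR).1 R' (mem_descendants.1 hR').1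

/-- The oscillation is taken on the parent because the Souza coefficients compare sample points of
child and parent. Each parent is then counted once per child, at most `κ⁻¹` times. -/
theorem sum_osc_parent_le (h : IsIntervalGrid m P κ θ) {β : ℝ} (hβ : 0 < β) (a : ℝ → ℂ)
    {j k : ℕ} (hjk : j ≤ k) {Q : Set ℝ} (hQ : Q ∈ P j) :
    ∑ R ∈ descendants P (k + 1) Q, osc a (ancestor P k R) ^ (1 / β) ≤
      κ⁻¹ * powerVar β a (interior Q) ^ (1 / β) := by
  rw [h.sum_descendants_eq hjk (Nat.le_succ k) hQ]
  calc ∑ S ∈ descendants P k Q, ∑ R ∈ descendants P (k + 1) S, osc a (ancestor P k R) ^ (1 / β)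
      = ∑ S ∈ descendants P k Q, ∑ R ∈ descendants P (k + 1) S, osc a S ^ (1 / β) := by
        refine Finset.sum_congr rfl fun S hS => Finset.sum_congr rfl fun R hR => ?_
        rw [mem_descendants] at hS hR
        rw [h.ancestor_eq (Nat.le_succ k) hR.1 hS.1 hR.2]
    _ ≤ ∑ S ∈ descendants P k Q, κ⁻¹ * osc a S ^ (1 / β) := by
        refine Finset.sum_le_sum fun S hS => ?_
        rw [Finset.sum_const, nsmul_eq_mul]
        gcongr
        exact h.card_children_le (mem_descendants.1 hS).1
    _ ≤ κ⁻¹ * powerVar β a (interior Q) ^ (1 / β) := by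
        rw [← Finset.mul_sum]
        gcongr
        exact h.sum_osc_descendants_le hβ a k Q

/-- Hölder's inequality for the elements of level `k` inside an element `Q` of level `j`. -/
theorem sum_weight_mul_rpow_le (h : IsIntervalGrid m P κ θ) {p t β : ℝ} (hp : 1 ≤ p)
    (htβ : t ≤ β) (hβ : 0 < β) (hβp : β ≤ 1 / p) {j k : ℕ} (hjk : j ≤ k) {Q : Set ℝ} (hQ : Q ∈ P j)
    (Δ : Set ℝ → ℝ≥0∞) (X : ℝ≥0∞) (hX : ∑ R ∈ descendants P k Q, Δ R ^ (1 / β) ≤ X ^ (1 / β)) :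
    ∑ R ∈ descendants P k Q, m R ^ (1 - p * t) * Δ R ^ p ≤
      (θ ^ (k - j)) ^ (p * (β - t)) * m Q ^ (1 - p * t) * X ^ p := by
  have hp0 : 0 < p := by linarith
  have hpβ : p * β ≤ 1 := by rwa [le_div_iff₀ hp0, mul_comm] at hβp
  have hpos : 0 < p * β := by positivity
  have hm0 : ∀ R ∈ descendants P k Q, m R ≠ 0 := fun R hR => (h.pos k R (mem_descendants.1 hR).1).ne'
  have hQ0 : m Q ≠ 0 := (h.pos j Q hQ).ne'
  -- The case `t = β`: Hölder with weights `m R` and exponent `1 / (p * β)`, which is at least one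
  -- exactly because `β ≤ 1 / p`.
  have hholder : ∑ R ∈ descendants P k Q, m R ^ (1 - p * β) * Δ R ^ p ≤
      m Q ^ (1 - p * β) * X ^ p := by
    have key := ENNReal.inner_le_weight_mul_Lp_of_nonneg (descendants P k Q)
      (p := 1 / (p * β)) (by rw [le_div_iff₀ hpos]; linarith) (fun R => m R)
      (fun R => m R ^ (-(p * β)) * Δ R ^ p)
    have e1 : ∀ R ∈ descendants P k Q, m R * (m R ^ (-(p * β)) * Δ R ^ p) =
        m R ^ (1 - p * β) * Δ R ^ p := fun R hR => by
      rw [← mul_assoc, sub_eq_add_neg, ENNReal.rpow_add _ _ (hm0 R hR) (h.measure_ne_top R),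
        ENNReal.rpow_one]
    have e2 : ∀ R ∈ descendants P k Q, m R * (m R ^ (-(p * β)) * Δ R ^ p) ^ (1 / (p * β)) =
        Δ R ^ (1 / β) := fun R hR => by
      rw [ENNReal.mul_rpow_of_nonneg _ _ (by positivity), ← ENNReal.rpow_mul, ← ENNReal.rpow_mul,
        show -(p * β) * (1 / (p * β)) = -1 by field_simp,
        show p * (1 / (p * β)) = 1 / β by field_simp, ← mul_assoc, ENNReal.rpow_neg_one,
        ENNReal.mul_inv_cancel (hm0 R hR) (h.measure_ne_top R), one_mul]
    rw [Finset.sum_congr rfl e1, Finset.sum_congr rfl e2, one_div, inv_inv] at key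
    refine key.trans ?_
    gcongr
    · exact h.sum_descendants_measure_le k Q
    · calc (∑ R ∈ descendants P k Q, Δ R ^ (1 / β)) ^ (p * β) ≤ (X ^ (1 / β)) ^ (p * β) := by
            gcongr
        _ = X ^ p := by rw [← ENNReal.rpow_mul, show 1 / β * (p * β) = p by field_simp]
  -- The surplus power `m R ^ (p * (β - t))` is bounded through `m R ≤ θ ^ (k - j) * m Q`; this
  -- produces the geometric gain.
  calc ∑ R ∈ descendants P k Q, m R ^ (1 - p * t) * Δ R ^ p
      ≤ ∑ R ∈ descendants P k Q,
        (θ ^ (k - j) * m Q) ^ (p * (β - t)) * (m R ^ (1 - p * β) * Δ R ^ p) := by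
        refine Finset.sum_le_sum fun R hR => ?_
        rw [← mul_assoc, show 1 - p * t = p * (β - t) + (1 - p * β) by ring,
          ENNReal.rpow_add _ _ (hm0 R hR) (h.measure_ne_top R)]
        gcongr
        exact h.measure_le_pow_mul hjk (mem_descendants.1 hR).1 hQ (mem_descendants.1 hR).2
    _ ≤ (θ ^ (k - j) * m Q) ^ (p * (β - t)) * (m Q ^ (1 - p * β) * X ^ p) := by
        rw [← Finset.mul_sum]
        gcongr
    _ = (θ ^ (k - j)) ^ (p * (β - t)) * m Q ^ (1 - p * t) * X ^ p := by
        rw [ENNReal.mul_rpow_of_nonneg _ _ (mul_nonneg hp0.le (by linarith)),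
          show 1 - p * t = p * (β - t) + (1 - p * β) by ring,
          ENNReal.rpow_add _ _ hQ0 (h.measure_ne_top Q)]
        ring

end IsIntervalGrid

/-! ### Costs and convolution with a geometric sequence -/

section

variable {Ω : Type*}

/-- The contribution `(∑_{Q ∈ Pᵏ} |c_Q|ᵖ)^{1/p}` of level `k` to the cost. -/
def levelCost (p : ℝ) (P : ℕ → Finset (Set Ω)) (c : Set Ω → ℂ) (k : ℕ) : ℝ≥0∞ :=
  (∑ Q ∈ P k, ‖c Q‖ₑ ^ p) ^ (1 / p)

theorem levelCost_ne_top {p : ℝ} (hp : 1 ≤ p) (P : ℕ → Finset (Set Ω)) (c : Set Ω → ℂ) (k : ℕ) :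
    levelCost p P c k ≠ ∞ := by
  have : (∑ Q ∈ P k, ‖c Q‖ₑ ^ p) ≠ ∞ :=
    ENNReal.sum_ne_top.2 fun Q _ => ENNReal.rpow_ne_top_of_nonneg (by linarith) enorm_ne_top
  exact ENNReal.rpow_ne_top_of_nonneg (by positivity) this

theorem cost_top (p : ℝ) (P : ℕ → Finset (Set Ω)) (c : Set Ω → ℂ) :
    cost p ∞ P c = ⨆ k, levelCost p P c k := by
  simp [cost, levelCost]

theorem cost_of_ne_top {p : ℝ} {q : ℝ≥0∞} (hq : q ≠ ∞) (P : ℕ → Finset (Set Ω))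
    (c : Set Ω → ℂ) :
    cost p q P c = (∑' k, levelCost p P c k ^ q.toReal) ^ (1 / q.toReal) := by
  simp only [cost, levelCost, if_neg hq, ← ENNReal.rpow_mul]
  congr! 4
  ring

theorem one_le_toReal {q : ℝ≥0∞} (hq : 1 ≤ q) (hq' : q ≠ ∞) : 1 ≤ q.toReal := by
  simpa using ENNReal.toReal_mono hq' hq

theorem levelCost_le_cost {p : ℝ} {q : ℝ≥0∞} (hq : 1 ≤ q) (P : ℕ → Finset (Set Ω))
    (c : Set Ω → ℂ) (k : ℕ) : levelCost p P c k ≤ cost p q P c := by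
  by_cases hq' : q = ∞
  · rw [hq', cost_top]
    exact le_iSup (levelCost p P c) k
  · have h1 := one_le_toReal hq hq'
    rw [cost_of_ne_top hq', one_div, ENNReal.le_rpow_inv_iff (by linarith)]
    exact ENNReal.le_tsum k

theorem tsum_rpow_le_rpow_tsum {r : ℝ} (hr : 1 ≤ r) (x : ℕ → ℝ≥0∞) :
    ∑' k, x k ^ r ≤ (∑' k, x k) ^ r := by
  calc ∑' k, x k ^ r = ∑' k, x k * x k ^ (r - 1) := by
        congr! 2 with k
        conv_lhs => rw [show r = 1 + (r - 1) by ring,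
          ENNReal.rpow_add_of_nonneg _ _ zero_le_one (by linarith), ENNReal.rpow_one]
    _ ≤ ∑' k, x k * (∑' k, x k) ^ (r - 1) := by
        refine ENNReal.tsum_le_tsum fun k => ?_
        gcongr
        exact ENNReal.le_tsum k
    _ = (∑' k, x k) ^ r := by
        rw [ENNReal.tsum_mul_right]
        conv_rhs => rw [show r = 1 + (r - 1) by ring,
          ENNReal.rpow_add_of_nonneg _ _ zero_le_one (by linarith), ENNReal.rpow_one]

/-- The `ℓ^q` norm is at most the `ℓ¹` norm with constant one, hence bounds obtained this way are
uniform in `q`. -/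
theorem cost_le_tsum {p : ℝ} {q : ℝ≥0∞} (hq : 1 ≤ q) (P : ℕ → Finset (Set Ω))
    (c : Set Ω → ℂ) : cost p q P c ≤ ∑' k, levelCost p P c k := by
  by_cases hq' : q = ∞
  · rw [hq', cost_top]
    exact iSup_le fun k => ENNReal.le_tsum k
  · have h1 := one_le_toReal hq hq'
    rw [cost_of_ne_top hq', one_div, ENNReal.rpow_inv_le_iff (by linarith)]
    exact tsum_rpow_le_rpow_tsum h1 _

/-- This is the Cauchy product of a geometric series with `x`. -/
theorem tsum_sum_range_geometric (ρ : ℝ≥0∞) (x : ℕ → ℝ≥0∞) :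
    ∑' k, ∑ j ∈ Finset.range (k + 1), ρ ^ (k - j) * x j = (1 - ρ)⁻¹ * ∑' j, x j := by
  rw [← ENNReal.tsum_geometric, ← ENNReal.tsum_mul_right]
  simp_rw [← ENNReal.tsum_mul_left]
  rw [← ENNReal.tsum_prod, ← Finset.HasAntidiagonal.sigmaAntidiagonalEquivProd.tsum_eq (_ : ℕ × ℕ → ℝ≥0∞),
    ENNReal.tsum_sigma']
  refine tsum_congr fun k => ?_
  rw [← Finset.Nat.sum_antidiagonal_eq_sum_range_succ (fun j i => ρ ^ i * x j), tsum_fintype,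
    ← Finset.Nat.sum_antidiagonal_swap, ← Finset.sum_coe_sort]
  rfl

/-- Young's inequality for the convolution with a geometric sequence, for costs. -/
theorem cost_le_of_levelCost_le {p : ℝ} {q : ℝ≥0∞} (hq : 1 ≤ q) {P : ℕ → Finset (Set Ω)}
    {c e : Set Ω → ℂ} {C ρ : ℝ≥0∞}
    (h : ∀ k, levelCost p P e k ≤
      C * ∑ j ∈ Finset.range (k + 1), ρ ^ (k - j) * levelCost p P c j) :
    cost p q P e ≤ C * (1 - ρ)⁻¹ * cost p q P c := by
  have hgeom : ∀ k, ∑ j ∈ Finset.range (k + 1), ρ ^ (k - j) ≤ (1 - ρ)⁻¹ := fun k => by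
    have := Finset.sum_range_reflect (fun i => ρ ^ i) (k + 1)
    simp only [add_tsub_cancel_right] at this
    rw [this, ← ENNReal.tsum_geometric]
    exact ENNReal.sum_le_tsum _
  by_cases hq' : q = ∞
  · rw [hq', cost_top, cost_top]
    refine iSup_le fun k => (h k).trans ?_
    rw [mul_assoc]
    gcongr
    calc ∑ j ∈ Finset.range (k + 1), ρ ^ (k - j) * levelCost p P c j
        ≤ ∑ j ∈ Finset.range (k + 1), ρ ^ (k - j) * ⨆ k, levelCost p P c k := by
          gcongr with j
          exact le_iSup (levelCost p P c) j
      _ ≤ (1 - ρ)⁻¹ * ⨆ k, levelCost p P c k := by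
          rw [← Finset.sum_mul]
          gcongr
          exact hgeom k
  · have h1 := one_le_toReal hq hq'
    set r := q.toReal
    have hr : 0 < r := by linarith
    rw [cost_of_ne_top hq', cost_of_ne_top hq', one_div, ENNReal.rpow_inv_le_iff hr,
      ENNReal.mul_rpow_of_nonneg _ _ hr.le, ← ENNReal.rpow_mul, inv_mul_cancel₀ hr.ne',
      ENNReal.rpow_one]
    -- Hölder with weights `ρ ^ (k - j)`, of total mass at most `(1 - ρ)⁻¹`, costs `r - 1` powers of
    -- that mass; the summation over `k` costs the last one.
    calc ∑' k, levelCost p P e k ^ r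
        ≤ ∑' k, C ^ r * ((1 - ρ)⁻¹ ^ (r - 1) *
          ∑ j ∈ Finset.range (k + 1), ρ ^ (k - j) * levelCost p P c j ^ r) := by
          refine ENNReal.tsum_le_tsum fun k => ?_
          refine (ENNReal.rpow_le_rpow (h k) hr.le).trans ?_
          rw [ENNReal.mul_rpow_of_nonneg _ _ hr.le]
          gcongr
          have key := ENNReal.inner_le_weight_mul_Lp_of_nonneg (Finset.range (k + 1)) h1
            (fun j => ρ ^ (k - j)) (fun j => levelCost p P c j)
          refine (ENNReal.rpow_le_rpow key hr.le).trans ?_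
          rw [ENNReal.mul_rpow_of_nonneg _ _ hr.le, ← ENNReal.rpow_mul, ← ENNReal.rpow_mul,
            inv_mul_cancel₀ hr.ne', ENNReal.rpow_one,
            show (1 - r⁻¹) * r = r - 1 by field_simp]
          gcongr
          exact hgeom k
      _ = (C * (1 - ρ)⁻¹) ^ r * ∑' k, levelCost p P c k ^ r := by
          rw [ENNReal.tsum_mul_left, ENNReal.tsum_mul_left, tsum_sum_range_geometric,
            ENNReal.mul_rpow_of_nonneg _ _ hr.le]
          conv_rhs => rw [show r = (r - 1) + 1 by ring,
            ENNReal.rpow_add_of_nonneg (x := (1 - ρ)⁻¹) _ _ (by linarith) zero_le_one,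
            ENNReal.rpow_one]
          rw [show r - 1 + 1 = r by ring]
          ring

theorem Lp_sum_le {ι ι' : Type*} {p : ℝ} (hp : 1 ≤ p) (s : Finset ι) (t : Finset ι')
    (f : ι' → ι → ℝ≥0∞) :
    (∑ R ∈ s, (∑ j ∈ t, f j R) ^ p) ^ (1 / p) ≤ ∑ j ∈ t, (∑ R ∈ s, f j R ^ p) ^ (1 / p) := by
  have := Finset.le_sum_of_subadditive (fun g : ι → ℝ≥0∞ => (∑ R ∈ s, g R ^ p) ^ (1 / p))
    (by simp [show 0 < p by linarith]) (fun g g' => ENNReal.Lp_add_le s g g' hp) t f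
  simpa [Finset.sum_apply] using this

end

/-! ### Souza coefficients of a representation and their cost -/

/-- The level sum `∑_{Q ∈ Pᵏ} c_Q a_Q`. -/
def layer (P : ℕ → Finset (Set ℝ)) (c : Set ℝ → ℂ) (a : Set ℝ → ℝ → ℂ) (k : ℕ) (x : ℝ) : ℂ :=
  ∑ Q ∈ P k, c Q * a Q x

/-- The sum of the first `N` levels. -/
def partialSum (P : ℕ → Finset (Set ℝ)) (c : Set ℝ → ℂ) (a : Set ℝ → ℝ → ℂ) (N : ℕ) (x : ℝ) : ℂ :=
  ∑ k ∈ Finset.range N, layer P c a k x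

/-- The extremal Souza atom on `R`. -/
def souzaAtom (m : Measure ℝ) (s p : ℝ) (R : Set ℝ) : ℝ → ℂ :=
  R.indicator fun _ => ((m.real R ^ (s - 1 / p) : ℝ) : ℂ)

/-- The coefficients of the expansion in Souza atoms of a function that is represented by
`c` and `a`. -/
def souzaCoeff (m : Measure ℝ) (P : ℕ → Finset (Set ℝ)) (s p : ℝ) (c : Set ℝ → ℂ)
    (a : Set ℝ → ℝ → ℂ) (R : Set ℝ) : ℂ :=
  ((m.real R ^ (1 / p - s) : ℝ) : ℂ) * (partialSum P c a (level P R + 1) (innerPt R) -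
    partialSum P c a (level P R) (innerPt (ancestor P (level P R - 1) R)))

/-- The step function that on `R ∈ Pᵏ` bounds the oscillation of level `j` of a representation. -/
def oscStep (P : ℕ → Finset (Set ℝ)) (c : Set ℝ → ℂ) (a : Set ℝ → ℝ → ℂ) (j k : ℕ) (x : ℝ) :
    ℝ≥0∞ :=
  ∑ R ∈ P k, R.indicator (fun _ => ‖c (ancestor P j R)‖ₑ * osc (a (ancestor P j R)) R) x

/-- The atoms `a_Q` are bounded variation atoms. -/
def AtomFamily (m : Measure ℝ) (P : ℕ → Finset (Set ℝ)) (s β p : ℝ) (a : Set ℝ → ℝ → ℂ) : Prop :=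
  ∀ k, ∀ Q ∈ P k, a Q ∈ bvAtoms m s β p Q

namespace IsIntervalGrid

variable {m : Measure ℝ} {P : ℕ → Finset (Set ℝ)} {κ θ : ℝ≥0∞}

theorem ofReal_rpow (h : IsIntervalGrid m P κ θ) {k : ℕ} {R : Set ℝ} (hR : R ∈ P k) (r : ℝ) :
    ENNReal.ofReal (m.real R ^ r) = m R ^ r := by
  have h0 : 0 < m.real R := ENNReal.toReal_pos (h.pos k R hR).ne' (h.measure_ne_top R)
  rw [← ENNReal.ofReal_rpow_of_pos h0, measureReal_def, ENNReal.ofReal_toReal (h.measure_ne_top R)]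

theorem enorm_real_rpow (h : IsIntervalGrid m P κ θ) {k : ℕ} {R : Set ℝ} (hR : R ∈ P k) (r : ℝ) :
    ‖((m.real R ^ r : ℝ) : ℂ)‖ₑ = m R ^ r := by
  rw [← h.ofReal_rpow hR, ← ofReal_norm, Complex.norm_real, Real.norm_of_nonneg (by positivity)]

theorem powerVar_le (h : IsIntervalGrid m P κ θ) {s β p : ℝ} {k : ℕ} {Q : Set ℝ} (hQ : Q ∈ P k)
    {a : ℝ → ℂ} (ha : a ∈ bvAtoms m s β p Q) : powerVar β a (interior Q) ≤ m Q ^ (s - 1 / p) :=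
  h.ofReal_rpow hQ _ ▸ ha.2.2

/-- The sup bound on an atom holds only almost everywhere, whereas sampling needs it at a given
point. Some interior point satisfies it, and the variation bounds the change from there, whence the
factor 2. -/
theorem enorm_le_of_mem_interior (h : IsIntervalGrid m P κ θ) {s β p : ℝ} (hβ : 0 < β) {k : ℕ}
    {Q : Set ℝ} (hQ : Q ∈ P k) {a : ℝ → ℂ} (ha : a ∈ bvAtoms m s β p Q) {u : ℝ}
    (hu : u ∈ interior Q) : ‖a u‖ₑ ≤ 2 * m Q ^ (s - 1 / p) := by
  have hae : ∀ᵐ x ∂m, ‖a x‖ₑ ≤ m Q ^ (s - 1 / p) := by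
    have hb := ha.2.1
    rw [eLpNorm_exponent_top, h.ofReal_rpow hQ] at hb
    filter_upwards [ae_le_eLpNormEssSup (f := a) (μ := m)] with x hx using hx.trans hb
  obtain ⟨y, hy, hay⟩ := Measure.exists_mem_of_measure_ne_zero_of_ae
    (by rw [h.measure_interior hQ]; exact (h.pos k Q hQ).ne') (ae_restrict_of_ae (s := interior Q) hae)
  calc ‖a u‖ₑ = ‖(a u - a y) + a y‖ₑ := by rw [sub_add_cancel]
    _ ≤ ‖a u - a y‖ₑ + ‖a y‖ₑ := enorm_add_le _ _
    _ ≤ m Q ^ (s - 1 / p) + m Q ^ (s - 1 / p) :=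
        add_le_add ((enorm_sub_le_powerVar hβ hu hy).trans (h.powerVar_le hQ ha)) hay
    _ = 2 * m Q ^ (s - 1 / p) := (two_mul _).symm

theorem layer_eq (h : IsIntervalGrid m P κ θ) {s β p : ℝ} {c : Set ℝ → ℂ} {a : Set ℝ → ℝ → ℂ}
    (ha : AtomFamily m P s β p a) {j : ℕ} {Q : Set ℝ} (hQ : Q ∈ P j) {x : ℝ} (hx : x ∈ Q) :
    layer P c a j x = c Q * a Q x :=
  h.sum_eq_single hQ hx (fun Q => c Q * a Q x) fun Q' hQ' hxQ' => by
    simp [(ha j Q' hQ').1 x hxQ']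

theorem enorm_layer_sub_le (h : IsIntervalGrid m P κ θ) {s β p : ℝ} {c : Set ℝ → ℂ}
    {a : Set ℝ → ℝ → ℂ} (ha : AtomFamily m P s β p a) {j k : ℕ} (hjk : j ≤ k) {R : Set ℝ}
    (hR : R ∈ P k) {x y : ℝ} (hx : x ∈ interior R) (hy : y ∈ interior R) :
    ‖layer P c a j x - layer P c a j y‖ₑ ≤
      ‖c (ancestor P j R)‖ₑ * osc (a (ancestor P j R)) R := by
  have hsub := h.subset_ancestor hjk hR
  rw [h.layer_eq ha (h.ancestor_mem hjk hR) (hsub (interior_subset hx)),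
    h.layer_eq ha (h.ancestor_mem hjk hR) (hsub (interior_subset hy)), ← mul_sub, enorm_mul]
  gcongr
  exact enorm_sub_le_osc hx hy

/-- Weighted sums over level `k` of quantities with controlled `1/β`-sums inside each element of
level `j`. -/
theorem sum_level_le (h : IsIntervalGrid m P κ θ) {p t β : ℝ} (hp : 1 ≤ p)
    (htβ : t ≤ β) (hβ : 0 < β) (hβp : β ≤ 1 / p) {j k : ℕ} (hjk : j ≤ k)
    (c : Set ℝ → ℂ) (Δ : Set ℝ → Set ℝ → ℝ≥0∞) (X : Set ℝ → ℝ≥0∞) (D : ℝ≥0∞)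
    (hX : ∀ Q ∈ P j, ∑ R ∈ descendants P k Q, Δ Q R ^ (1 / β) ≤ X Q ^ (1 / β))
    (hD : ∀ Q ∈ P j, (θ ^ (k - j)) ^ (β - t) * m Q ^ (1 / p - t) * X Q ≤ D) :
    (∑ R ∈ P k, m R ^ (1 - p * t) * (‖c (ancestor P j R)‖ₑ * Δ (ancestor P j R) R) ^ p) ^ (1 / p) ≤
      D * levelCost p P c j := by
  have hp0 : 0 < p := by linarith
  rw [one_div, ENNReal.rpow_inv_le_iff hp0, ENNReal.mul_rpow_of_nonneg _ _ hp0.le, levelCost,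
    ← ENNReal.rpow_mul, one_div_mul_cancel hp0.ne', ENNReal.rpow_one, Finset.mul_sum,
    h.sum_eq_sum_descendants hjk]
  refine Finset.sum_le_sum fun Q hQ => ?_
  calc ∑ R ∈ descendants P k Q,
        m R ^ (1 - p * t) * (‖c (ancestor P j R)‖ₑ * Δ (ancestor P j R) R) ^ p
      = ‖c Q‖ₑ ^ p * ∑ R ∈ descendants P k Q, m R ^ (1 - p * t) * Δ Q R ^ p := by
        rw [Finset.mul_sum]
        refine Finset.sum_congr rfl fun R hR => ?_
        rw [mem_descendants] at hR
        rw [h.ancestor_eq hjk hR.1 hQ hR.2, ENNReal.mul_rpow_of_nonneg _ _ hp0.le]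
        ring
    _ ≤ ‖c Q‖ₑ ^ p * ((θ ^ (k - j)) ^ (p * (β - t)) * m Q ^ (1 - p * t) * X Q ^ p) := by
        gcongr
        exact h.sum_weight_mul_rpow_le hp htβ hβ hβp hjk hQ _ _ (hX Q hQ)
    _ = ‖c Q‖ₑ ^ p * ((θ ^ (k - j)) ^ (β - t) * m Q ^ (1 / p - t) * X Q) ^ p := by
        rw [ENNReal.mul_rpow_of_nonneg _ _ hp0.le, ENNReal.mul_rpow_of_nonneg _ _ hp0.le,
          ← ENNReal.rpow_mul, ← ENNReal.rpow_mul]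
        congr 4
        · ring
        · field_simp
    _ ≤ D ^ p * ‖c Q‖ₑ ^ p := by
        rw [mul_comm]
        gcongr
        exact hD Q hQ

/-- The case `t = s` of the weighted estimate: the normalization of the atoms cancels the powers of
`m Q` and leaves decay in the level difference. -/
theorem sum_osc_parent_rpow_le (h : IsIntervalGrid m P κ θ) {s β p : ℝ} (hp : 1 ≤ p)
    (hsβ : s ≤ β) (hβ : 0 < β) (hβp : β ≤ 1 / p) (c : Set ℝ → ℂ) {a : Set ℝ → ℝ → ℂ}
    (ha : AtomFamily m P s β p a) {j k : ℕ} (hj : j ≤ k) :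
    (∑ R ∈ P (k + 1), (m R ^ (1 / p - s) *
      (‖c (ancestor P j R)‖ₑ * osc (a (ancestor P j R)) (ancestor P k R))) ^ p) ^ (1 / p) ≤
      κ⁻¹ ^ β * (θ ^ (β - s)) ^ (k + 1 - j) * levelCost p P c j := by
  have hp0 : 0 < p := by linarith
  have e : ∀ R ∈ P (k + 1), (m R ^ (1 / p - s) *
      (‖c (ancestor P j R)‖ₑ * osc (a (ancestor P j R)) (ancestor P k R))) ^ p =
      m R ^ (1 - p * s) *
        (‖c (ancestor P j R)‖ₑ * osc (a (ancestor P j R)) (ancestor P k R)) ^ p := fun R _ => by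
    rw [ENNReal.mul_rpow_of_nonneg _ _ hp0.le, ← ENNReal.rpow_mul,
      show (1 / p - s) * p = 1 - p * s by field_simp]
  rw [Finset.sum_congr rfl e]
  refine h.sum_level_le hp hsβ hβ hβp (hj.trans k.le_succ) c
    (fun Q R => osc (a Q) (ancestor P k R))
    (fun Q => κ⁻¹ ^ β * m Q ^ (s - 1 / p)) _ (fun Q hQ => ?_) fun Q hQ => ?_
  · refine (h.sum_osc_parent_le hβ (a Q) hj hQ).trans ?_
    rw [ENNReal.mul_rpow_of_nonneg _ _ (by positivity), ← ENNReal.rpow_mul,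
      mul_one_div_cancel hβ.ne', ENNReal.rpow_one]
    gcongr
    exact h.powerVar_le hQ (ha j Q hQ)
  · have h1 : m Q ^ (1 / p - s) * m Q ^ (s - 1 / p) = 1 := by
      rw [← ENNReal.rpow_add _ _ (h.pos j Q hQ).ne' (h.measure_ne_top Q)]
      simp
    have h2 : (θ ^ (k + 1 - j)) ^ (β - s) = (θ ^ (β - s)) ^ (k + 1 - j) := by
      rw [← ENNReal.rpow_natCast, ← ENNReal.rpow_natCast, ← ENNReal.rpow_mul,
        ← ENNReal.rpow_mul, mul_comm]
    rw [h2]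
    refine le_of_eq ?_
    calc (θ ^ (β - s)) ^ (k + 1 - j) * m Q ^ (1 / p - s) * (κ⁻¹ ^ β * m Q ^ (s - 1 / p))
        = κ⁻¹ ^ β * (θ ^ (β - s)) ^ (k + 1 - j) * (m Q ^ (1 / p - s) * m Q ^ (s - 1 / p)) := by
          ring
      _ = _ := by rw [h1, mul_one]

/-- The 2 comes from the level `k` atom sampled at its own point, and `κ⁻¹ ^ β` from the
oscillations of coarser atoms on parents. Minkowski's inequality sums over the levels `j`. -/
theorem levelCost_souzaCoeff_le (h : IsIntervalGrid m P κ θ) {s β p : ℝ} (hp : 1 ≤ p)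
    (hsβ : s ≤ β) (hβ : 0 < β) (hβp : β ≤ 1 / p) {c : Set ℝ → ℂ} {a : Set ℝ → ℝ → ℂ}
    (ha : AtomFamily m P s β p a) (k : ℕ) :
    levelCost p P (souzaCoeff m P s p c a) k ≤ (2 + κ⁻¹ ^ β) *
      ∑ j ∈ Finset.range (k + 1), (θ ^ (β - s)) ^ (k - j) * levelCost p P c j := by
  have hp0 : 0 < p := by linarith
  set f : ℕ → Set ℝ → ℝ≥0∞ := fun j R => if j = k then 2 * ‖c R‖ₑ else
    m R ^ (1 / p - s) * (‖c (ancestor P j R)‖ₑ * osc (a (ancestor P j R)) (ancestor P (k - 1) R))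
    with hf
  have hfk : ∀ R, f k R = 2 * ‖c R‖ₑ := fun R => by simp [hf]
  have hfj : ∀ j < k, ∀ R, f j R = m R ^ (1 / p - s) *
      (‖c (ancestor P j R)‖ₑ * osc (a (ancestor P j R)) (ancestor P (k - 1) R)) :=
    fun j hj R => by simp [hf, hj.ne]
  have hcancel : ∀ Q ∈ P k, m Q ^ (1 / p - s) * m Q ^ (s - 1 / p) = 1 := fun Q hQ => by
    rw [← ENNReal.rpow_add _ _ (h.pos k Q hQ).ne' (h.measure_ne_top Q)]
    simp
  have hpoint : ∀ R ∈ P k, ‖souzaCoeff m P s p c a R‖ₑ ≤ ∑ j ∈ Finset.range (k + 1), f j R := by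
    intro R hR
    have hx := h.innerPt_mem_interior hR
    rw [souzaCoeff, h.level_eq hR, enorm_mul, h.enorm_real_rpow hR]
    -- Level `k` enters only the first partial sum, so it is left without a partner; each coarser
    -- level appears as a difference.
    have hsplit : partialSum P c a (k + 1) (innerPt R) -
        partialSum P c a k (innerPt (ancestor P (k - 1) R)) =
        (∑ j ∈ Finset.range k, (layer P c a j (innerPt R) -
          layer P c a j (innerPt (ancestor P (k - 1) R)))) + layer P c a k (innerPt R) := by
      rw [partialSum, partialSum, Finset.sum_range_succ, Finset.sum_sub_distrib]
      ring
    rw [hsplit, Finset.sum_range_succ, hfk]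
    refine (mul_le_mul_right (enorm_add_le _ _) _).trans ?_
    rw [mul_add]
    refine add_le_add ?_ ?_
    · refine (mul_le_mul_right (enorm_sum_le _ _) _).trans ?_
      rw [Finset.mul_sum]
      refine Finset.sum_le_sum fun j hj => ?_
      rw [Finset.mem_range] at hj
      rw [hfj j hj]
      gcongr
      have hS : ancestor P (k - 1) R ∈ P (k - 1) := h.ancestor_mem (Nat.sub_le k 1) hR
      rw [← h.ancestor_ancestor (by omega : j ≤ k - 1) (Nat.sub_le k 1) hR]
      exact h.enorm_layer_sub_le ha (by omega) hS
        (interior_mono (h.subset_ancestor (Nat.sub_le k 1) hR) hx) (h.innerPt_mem_interior hS)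
    · rw [h.layer_eq ha hR (h.innerPt_mem hR), enorm_mul]
      calc m R ^ (1 / p - s) * (‖c R‖ₑ * ‖a R (innerPt R)‖ₑ)
          ≤ m R ^ (1 / p - s) * (‖c R‖ₑ * (2 * m R ^ (s - 1 / p))) := by
            gcongr
            exact h.enorm_le_of_mem_interior hβ hR (ha k R hR) hx
        _ = 2 * ‖c R‖ₑ * (m R ^ (1 / p - s) * m R ^ (s - 1 / p)) := by ring
        _ = 2 * ‖c R‖ₑ := by rw [hcancel R hR, mul_one]
  have hlast : (∑ R ∈ P k, f k R ^ p) ^ (1 / p) = 2 * levelCost p P c k := by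
    simp_rw [hfk, ENNReal.mul_rpow_of_nonneg _ _ hp0.le]
    rw [← Finset.mul_sum, ENNReal.mul_rpow_of_nonneg _ _ (by positivity), ← ENNReal.rpow_mul,
      mul_one_div_cancel hp0.ne', ENNReal.rpow_one, levelCost]
  have hterm : ∀ j < k, (∑ R ∈ P k, f j R ^ p) ^ (1 / p) ≤
      κ⁻¹ ^ β * (θ ^ (β - s)) ^ (k - j) * levelCost p P c j := by
    intro j hj
    simp only [hfj j hj]
    obtain ⟨k, rfl⟩ : ∃ i, k = i + 1 := ⟨k - 1, by omega⟩
    exact h.sum_osc_parent_rpow_le hp hsβ hβ hβp c ha (by omega)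
  calc levelCost p P (souzaCoeff m P s p c a) k
      ≤ (∑ R ∈ P k, (∑ j ∈ Finset.range (k + 1), f j R) ^ p) ^ (1 / p) := by
        rw [levelCost]
        gcongr with R hR
        exact hpoint R hR
    _ ≤ ∑ j ∈ Finset.range (k + 1), (∑ R ∈ P k, f j R ^ p) ^ (1 / p) := Lp_sum_le hp _ _ _
    _ ≤ ∑ j ∈ Finset.range (k + 1),
        (2 + κ⁻¹ ^ β) * ((θ ^ (β - s)) ^ (k - j) * levelCost p P c j) := by
        refine Finset.sum_le_sum fun j hj => ?_
        rcases (Nat.lt_succ_iff.1 (Finset.mem_range.1 hj)).eq_or_lt with rfl | hj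
        · rw [hlast, Nat.sub_self, pow_zero, one_mul]
          gcongr
          exact le_self_add
        · refine (hterm j hj).trans ?_
          rw [mul_assoc]
          gcongr
          exact le_add_self
    _ = _ := (Finset.mul_sum _ _ _).symm

end IsIntervalGrid

/-! ### Measurability and convergence in `L^p` -/

namespace IsIntervalGrid

variable {m : Measure ℝ} {P : ℕ → Finset (Set ℝ)} {κ θ : ℝ≥0∞}

theorem lintegral_sum_indicator_rpow (h : IsIntervalGrid m P κ θ) {p : ℝ} (hp : 0 < p) (k : ℕ)
    (v : Set ℝ → ℝ≥0∞) :
    ∫⁻ x, (∑ R ∈ P k, R.indicator (fun _ => v R) x) ^ p ∂m = ∑ R ∈ P k, m R * v R ^ p := by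
  have hpt : ∀ x, (∑ R ∈ P k, R.indicator (fun _ => v R) x) ^ p =
      ∑ R ∈ P k, R.indicator (fun _ => v R ^ p) x := by
    intro x
    by_cases hx : ∃ R ∈ P k, x ∈ R
    · obtain ⟨R, hR, hxR⟩ := hx
      rw [h.sum_eq_single hR hxR _ fun Q _ hxQ => Set.indicator_of_notMem hxQ _,
        h.sum_eq_single hR hxR _ fun Q _ hxQ => Set.indicator_of_notMem hxQ _,
        Set.indicator_of_mem hxR, Set.indicator_of_mem hxR]
    · push Not at hx
      rw [Finset.sum_eq_zero fun R hR => Set.indicator_of_notMem (hx R hR) _,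
        Finset.sum_eq_zero fun R hR => Set.indicator_of_notMem (hx R hR) _,
        ENNReal.zero_rpow_of_pos hp]
  simp_rw [hpt]
  rw [lintegral_finsetSum _ fun R hR => measurable_const.indicator (h.measurable k R hR)]
  refine Finset.sum_congr rfl fun R hR => ?_
  rw [lintegral_indicator_const (h.measurable k R hR), mul_comm]

theorem measurable_oscStep (h : IsIntervalGrid m P κ θ) (c : Set ℝ → ℂ) (a : Set ℝ → ℝ → ℂ)
    (j k : ℕ) : Measurable (oscStep P c a j k) :=
  Finset.measurable_fun_sum _ fun R hR => measurable_const.indicator (h.measurable k R hR)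

/-- The case `t = 0` of the weighted estimate. The remaining `m Q ^ s` is at most `(θ ^ j) ^ s`,
which completes the decay in `k - j` to decay in `k`. -/
theorem lintegral_oscStep_le (h : IsIntervalGrid m P κ θ) {s β p : ℝ} (hp : 1 ≤ p)
    (hs : 0 < s) (hsβ : s ≤ β) (hβp : β ≤ 1 / p) (c : Set ℝ → ℂ) {a : Set ℝ → ℝ → ℂ}
    (ha : AtomFamily m P s β p a) {j k : ℕ} (hj : j ≤ k) :
    (∫⁻ x, oscStep P c a j k x ^ p ∂m) ^ (1 / p) ≤ (θ ^ s) ^ k * levelCost p P c j := by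
  have hp0 : 0 < p := by linarith
  have hβ : 0 < β := by linarith
  have hθ : ∀ n : ℕ, (θ ^ n) ^ s = (θ ^ s) ^ n := fun n => by
    rw [← ENNReal.rpow_natCast, ← ENNReal.rpow_natCast, ← ENNReal.rpow_mul,
      ← ENNReal.rpow_mul, mul_comm]
  simp only [oscStep]
  rw [h.lintegral_sum_indicator_rpow hp0]
  have := h.sum_level_le (t := 0) hp hβ.le hβ hβp hj c (fun Q R => osc (a Q) R)
    (fun Q => m Q ^ (s - 1 / p)) ((θ ^ s) ^ k) (fun Q hQ => ?_) fun Q hQ => ?_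
  · simpa using this
  · refine (h.sum_osc_descendants_le hβ (a Q) k Q).trans ?_
    gcongr
    exact h.powerVar_le hQ (ha j Q hQ)
  · rw [sub_zero, sub_zero, mul_assoc, ← ENNReal.rpow_add _ _ (h.pos j Q hQ).ne' (h.measure_ne_top Q),
      add_sub_cancel]
    calc (θ ^ (k - j)) ^ β * m Q ^ s ≤ (θ ^ (k - j)) ^ s * (θ ^ j) ^ s := by
          refine mul_le_mul' (ENNReal.rpow_le_rpow_of_exponent_ge ?_ hsβ) ?_
          · exact pow_le_one₀ zero_le h.θ_lt_one.le
          · exact ENNReal.rpow_le_rpow (h.measure_le_pow hQ) hs.le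
      _ = (θ ^ s) ^ k := by rw [hθ, hθ, ← pow_add, Nat.sub_add_cancel hj]

theorem oscStep_eq (h : IsIntervalGrid m P κ θ) (c : Set ℝ → ℂ) (a : Set ℝ → ℝ → ℂ) {j k : ℕ}
    {R : Set ℝ} (hR : R ∈ P k) {x : ℝ} (hx : x ∈ R) :
    oscStep P c a j k x = ‖c (ancestor P j R)‖ₑ * osc (a (ancestor P j R)) R := by
  rw [oscStep, h.sum_eq_single hR hx _ fun Q _ hxQ => Set.indicator_of_notMem hxQ _,
    Set.indicator_of_mem hx]

theorem rpow_lt_one (h : IsIntervalGrid m P κ θ) {s : ℝ} (hs : 0 < s) : θ ^ s < 1 :=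
  ENNReal.rpow_lt_one h.θ_lt_one hs

/-- Measurability is not part of the definition of an atom. It follows from bounded variation: step
functions sampled on finer levels converge almost everywhere, because the `p`-th powers of the
oscillations have summable integrals. Minkowski's inequality for the error needs it later. -/
theorem aestronglyMeasurable_layer (h : IsIntervalGrid m P κ θ) {s β p : ℝ} (hp : 1 ≤ p)
    (hs : 0 < s) (hsβ : s ≤ β) (hβp : β ≤ 1 / p) (c : Set ℝ → ℂ) {a : Set ℝ → ℝ → ℂ}
    (ha : AtomFamily m P s β p a) (j : ℕ) : AEStronglyMeasurable (layer P c a j) m := by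
  have hp0 : 0 < p := by linarith
  have hρ : (θ ^ s) ^ p < 1 := ENNReal.rpow_lt_one (h.rpow_lt_one hs) hp0
  have hfin : ∫⁻ x, ∑' i, oscStep P c a j (j + i) x ^ p ∂m ≠ ∞ := by
    rw [lintegral_tsum fun i => ((h.measurable_oscStep c a j (j + i)).pow_const p).aemeasurable]
    refine ne_top_of_le_ne_top (b := ∑' i, ((θ ^ s) ^ p) ^ i * levelCost p P c j ^ p) ?_
      (ENNReal.tsum_le_tsum fun i => ?_)
    · rw [ENNReal.tsum_mul_right, ENNReal.tsum_geometric]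
      exact ENNReal.mul_ne_top (ENNReal.inv_ne_top.2 (tsub_pos_of_lt hρ).ne')
        (ENNReal.rpow_ne_top_of_nonneg hp0.le (levelCost_ne_top hp P c j))
    · have := h.lintegral_oscStep_le hp hs hsβ hβp c ha (Nat.le_add_right j i)
      rw [one_div, ENNReal.rpow_inv_le_iff hp0, ENNReal.mul_rpow_of_nonneg _ _ hp0.le] at this
      refine this.trans ?_
      gcongr
      rw [← ENNReal.rpow_natCast, ← ENNReal.rpow_mul, mul_comm, ENNReal.rpow_mul,
        ENNReal.rpow_natCast]
      exact pow_le_pow_right_of_le_one' hρ.le (Nat.le_add_left i j)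
  have hae := ae_lt_top (Measurable.tsum fun i =>
    (h.measurable_oscStep c a j (j + i)).pow_const p) hfin
  refine aestronglyMeasurable_of_tendsto_ae atTop (f := fun i x => ∑ R ∈ P (j + i),
    R.indicator (fun _ => layer P c a j (innerPt R)) x) (fun i => ?_) ?_
  · exact (Finset.measurable_fun_sum _ fun R hR =>
      measurable_const.indicator (h.measurable (j + i) R hR)).aestronglyMeasurable
  · filter_upwards [hae, h.ae_mem] with x hx hmem
    have h0 : Tendsto (fun i => oscStep P c a j (j + i) x) atTop (𝓝 0) := by
      have h1 := (ENNReal.tendsto_atTop_zero_of_tsum_ne_top hx.ne).ennrpow_const p⁻¹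
      simpa [← ENNReal.rpow_mul, mul_inv_cancel₀ hp0.ne', hp0] using h1
    rw [tendsto_iff_edist_tendsto_0]
    refine tendsto_of_tendsto_of_tendsto_of_le_of_le tendsto_const_nhds h0 (fun _ => zero_le)
      fun i => ?_
    obtain ⟨R, hR, hxR⟩ := hmem (j + i)
    have hxR' := interior_subset hxR
    beta_reduce
    rw [h.oscStep_eq c a hR hxR', edist_eq_enorm_sub,
      h.sum_eq_single hR hxR' _ fun Q _ hxQ => Set.indicator_of_notMem hxQ _,
      Set.indicator_of_mem hxR']
    exact h.enorm_layer_sub_le ha (Nat.le_add_right j i) hR (h.innerPt_mem_interior hR) hxR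

theorem aestronglyMeasurable_partialSum (h : IsIntervalGrid m P κ θ) {s β p : ℝ} (hp : 1 ≤ p)
    (hs : 0 < s) (hsβ : s ≤ β) (hβp : β ≤ 1 / p) (c : Set ℝ → ℂ) {a : Set ℝ → ℝ → ℂ}
    (ha : AtomFamily m P s β p a) (N : ℕ) : AEStronglyMeasurable (partialSum P c a N) m :=
  Finset.aestronglyMeasurable_fun_sum _ fun j _ =>
    h.aestronglyMeasurable_layer hp hs hsβ hβp c ha j

theorem lintegral_Lp_sum_le {ι : Type*} {p : ℝ} (hp : 1 ≤ p) (t : Finset ι) (f : ι → ℝ → ℝ≥0∞)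
    (hf : ∀ i ∈ t, Measurable (f i)) (m : Measure ℝ) :
    (∫⁻ x, (∑ i ∈ t, f i x) ^ p ∂m) ^ (1 / p) ≤ ∑ i ∈ t, (∫⁻ x, f i x ^ p ∂m) ^ (1 / p) := by
  classical
  induction t using Finset.induction_on with
  | empty => simp [show 0 < p by linarith]
  | insert i t hi ih =>
    simp only [Finset.sum_insert hi]
    have hm : AEMeasurable (fun x => ∑ i ∈ t, f i x) m := (Finset.measurable_fun_sum _ fun i hi =>
      hf i (Finset.mem_insert_of_mem hi)).aemeasurable
    refine (ENNReal.lintegral_Lp_add_le (hf i (Finset.mem_insert_self _ _)).aemeasurable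
      hm hp).trans ?_
    gcongr
    exact ih fun i hi => hf i (Finset.mem_insert_of_mem hi)

theorem eLpNorm_le_of_enorm_le {p : ℝ} (hp : 1 ≤ p) {f : ℝ → ℂ} {g : ℝ → ℝ≥0∞}
    (hfg : ∀ᵐ x ∂m, ‖f x‖ₑ ≤ g x) :
    eLpNorm f (ENNReal.ofReal p) m ≤ (∫⁻ x, g x ^ p ∂m) ^ (1 / p) := by
  have hp0 : 0 < p := by linarith
  rw [eLpNorm_eq_lintegral_rpow_enorm_toReal (by simpa using hp0) ENNReal.ofReal_ne_top,
    ENNReal.toReal_ofReal hp0.le]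
  gcongr ?_ ^ _
  refine lintegral_mono_ae (hfg.mono fun x hx => ?_)
  gcongr

theorem layer_souza_eq (h : IsIntervalGrid m P κ θ) {s p : ℝ} (e : Set ℝ → ℂ) {k : ℕ} {R : Set ℝ}
    (hR : R ∈ P k) {x : ℝ} (hx : x ∈ R) :
    layer P e (souzaAtom m s p) k x = e R * ((m.real R ^ (s - 1 / p) : ℝ) : ℂ) := by
  rw [layer, h.sum_eq_single hR hx (fun Q => e Q * souzaAtom m s p Q x), souzaAtom,
    Set.indicator_of_mem hx]
  exact fun Q _ hxQ => by rw [souzaAtom, Set.indicator_of_notMem hxQ, mul_zero]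

/-- The expansion in Souza atoms telescopes. -/
theorem partialSum_souzaCoeff (h : IsIntervalGrid m P κ θ) {s p : ℝ} (c : Set ℝ → ℂ)
    (a : Set ℝ → ℝ → ℂ) {x : ℝ} {N : ℕ} {R : Set ℝ}
    (hR : R ∈ P N) (hxR : x ∈ R) :
    partialSum P (souzaCoeff m P s p c a) (souzaAtom m s p) (N + 1) x =
      partialSum P c a (N + 1) (innerPt R) := by
  have hlayer : ∀ {k : ℕ} {R : Set ℝ}, R ∈ P k → x ∈ R →
      layer P (souzaCoeff m P s p c a) (souzaAtom m s p) k x =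
      partialSum P c a (k + 1) (innerPt R) -
        partialSum P c a k (innerPt (ancestor P (k - 1) R)) := by
    intro k R hR hxR
    have hpos : 0 < m.real R := ENNReal.toReal_pos (h.pos k R hR).ne' (h.measure_ne_top R)
    rw [h.layer_souza_eq _ hR hxR, souzaCoeff, h.level_eq hR, mul_right_comm, ← Complex.ofReal_mul,
      ← Real.rpow_add hpos]
    simp
  induction N generalizing R with
  -- The subtracted partial sum is empty, so the truncated index `0 - 1` plays no role.
  | zero =>
    rw [partialSum, Finset.sum_range_one, hlayer hR hxR]
    simp [partialSum]
  | succ N ih =>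
    rw [partialSum, Finset.sum_range_succ, ← partialSum, hlayer hR hxR]
    have hS := h.ancestor_mem (Nat.le_succ N) hR
    rw [ih hS (h.subset_ancestor (Nat.le_succ N) hR hxR), Nat.add_sub_cancel, add_sub_cancel]

/-- By telescoping, the Souza sum on `R` is the value of the other sum at the sample point of `R`,
so the error is a sum of oscillations on `R`, one for each level. -/
theorem eLpNorm_partialSum_sub_le (h : IsIntervalGrid m P κ θ) {s β p : ℝ} (hp : 1 ≤ p)
    (hs : 0 < s) (hsβ : s ≤ β) (hβp : β ≤ 1 / p) (c : Set ℝ → ℂ) {a : Set ℝ → ℝ → ℂ}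
    (ha : AtomFamily m P s β p a) (N : ℕ) :
    eLpNorm (fun x => partialSum P c a (N + 1) x -
      partialSum P (souzaCoeff m P s p c a) (souzaAtom m s p) (N + 1) x) (ENNReal.ofReal p) m ≤
      (θ ^ s) ^ N * ∑ j ∈ Finset.range (N + 1), levelCost p P c j := by
  refine (eLpNorm_le_of_enorm_le hp (g := fun x => ∑ j ∈ Finset.range (N + 1),
    oscStep P c a j N x) ?_).trans ?_
  · filter_upwards [h.ae_mem] with x hx
    obtain ⟨R, hR, hxR⟩ := hx N
    rw [h.partialSum_souzaCoeff c a hR (interior_subset hxR), partialSum, partialSum,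
      ← Finset.sum_sub_distrib]
    refine (enorm_sum_le _ _).trans (Finset.sum_le_sum fun j hj => ?_)
    rw [h.oscStep_eq c a hR (interior_subset hxR)]
    exact h.enorm_layer_sub_le ha (Nat.lt_succ_iff.1 (Finset.mem_range.1 hj)) hR hxR
      (h.innerPt_mem_interior hR)
  · refine (lintegral_Lp_sum_le hp _ _ (fun j _ => h.measurable_oscStep c a j N) m).trans ?_
    rw [Finset.mul_sum]
    exact Finset.sum_le_sum fun j hj =>
      h.lintegral_oscStep_le hp hs hsβ hβp c ha (Nat.lt_succ_iff.1 (Finset.mem_range.1 hj))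

theorem measurable_layer_souza (h : IsIntervalGrid m P κ θ) (s p : ℝ) (e : Set ℝ → ℂ) (k : ℕ) :
    Measurable (layer P e (souzaAtom m s p) k) :=
  Finset.measurable_fun_sum _ fun R hR =>
    measurable_const.mul (measurable_const.indicator (h.measurable k R hR))

theorem eLpNorm_layer_souza_le (h : IsIntervalGrid m P κ θ) {s p : ℝ} (hp : 1 ≤ p) (hs : 0 < s)
    (e : Set ℝ → ℂ) (k : ℕ) :
    eLpNorm (layer P e (souzaAtom m s p) k) (ENNReal.ofReal p) m ≤
      (θ ^ s) ^ k * levelCost p P e k := by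
  have hp0 : 0 < p := by linarith
  refine (eLpNorm_le_of_enorm_le hp (g := fun x => ∑ R ∈ P k,
    R.indicator (fun _ => ‖e R‖ₑ * m R ^ (s - 1 / p)) x) ?_).trans ?_
  · filter_upwards [h.ae_mem] with x hx
    obtain ⟨R, hR, hxR⟩ := hx k
    have hxR' := interior_subset hxR
    rw [h.layer_souza_eq e hR hxR', h.sum_eq_single hR hxR' _
      fun Q _ hxQ => Set.indicator_of_notMem hxQ _, Set.indicator_of_mem hxR', enorm_mul,
      h.enorm_real_rpow hR]
  · rw [h.lintegral_sum_indicator_rpow hp0, one_div, ENNReal.rpow_inv_le_iff hp0,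
      ENNReal.mul_rpow_of_nonneg _ _ hp0.le, levelCost, ← ENNReal.rpow_mul,
      one_div_mul_cancel hp0.ne', ENNReal.rpow_one, Finset.mul_sum]
    refine Finset.sum_le_sum fun R hR => ?_
    calc m R * (‖e R‖ₑ * m R ^ (s - p⁻¹)) ^ p
        = (m R ^ (1 : ℝ) * m R ^ ((s - p⁻¹) * p)) * ‖e R‖ₑ ^ p := by
          rw [ENNReal.mul_rpow_of_nonneg _ _ hp0.le, ← ENNReal.rpow_mul, ENNReal.rpow_one]
          ring
      _ = (m R ^ s) ^ p * ‖e R‖ₑ ^ p := by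
          rw [← ENNReal.rpow_add _ _ (h.pos k R hR).ne' (h.measure_ne_top R), ← ENNReal.rpow_mul]
          congr 2
          field_simp
          ring
      _ ≤ ((θ ^ s) ^ k) ^ p * ‖e R‖ₑ ^ p := by
          gcongr
          refine (ENNReal.rpow_le_rpow (h.measure_le_pow hR) hs.le).trans (le_of_eq ?_)
          rw [← ENNReal.rpow_natCast, ← ENNReal.rpow_natCast, ← ENNReal.rpow_mul,
            ← ENNReal.rpow_mul, mul_comm]

theorem souzaAtom_mem (h : IsIntervalGrid m P κ θ) (s p : ℝ) {k : ℕ} {R : Set ℝ} (hR : R ∈ P k) :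
    souzaAtom m s p R ∈ souzaAtoms m s p R := by
  refine ⟨fun x hx => Set.indicator_of_notMem hx _,
    ⟨_, fun x hx => Set.indicator_of_mem hx _⟩, ?_⟩
  rw [eLpNorm_exponent_top, h.ofReal_rpow hR, ← h.enorm_real_rpow hR]
  exact eLpNormEssSup_le_of_ae_enorm_bound (ae_of_all _ fun x => by
    by_cases hx : x ∈ R <;> simp [souzaAtom, hx])

/-- A function represented by atoms of bounded variation with bounded level costs has a
representation by Souza atoms, provided the new coefficients have finite cost. -/
theorem isRepresentation_souza (h : IsIntervalGrid m P κ θ) {s β p : ℝ} (hp : 1 ≤ p)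
    (hs : 0 < s) (hsβ : s ≤ β) (hβp : β ≤ 1 / p) {c : Set ℝ → ℂ} {a : Set ℝ → ℝ → ℂ}
    (ha : AtomFamily m P s β p a) {L : ℝ≥0∞} (hL : L ≠ ∞) (hcL : ∀ k, levelCost p P c k ≤ L)
    {g : ℝ → ℂ} (hg : AEStronglyMeasurable g m)
    (hlim : Tendsto (fun N => eLpNorm (fun x => g x - partialSum P c a N x) (ENNReal.ofReal p) m)
      atTop (𝓝 0)) {q : ℝ≥0∞} (hq : 1 ≤ q) (hcost : cost p q P (souzaCoeff m P s p c a) < ∞) :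
    IsRepresentation m P (souzaAtoms m s p) p q g (souzaCoeff m P s p c a) (souzaAtom m s p) where
  atom k Q hQ := h.souzaAtom_mem s p hQ
  cost_lt := hcost
  abs_conv := by
    rw [max_eq_left hp, div_self (by linarith)]
    simp only [ENNReal.rpow_one]
    calc ∑' k, eLpNorm (layer P (souzaCoeff m P s p c a) (souzaAtom m s p) k) (ENNReal.ofReal p) m
        ≤ ∑' k, (θ ^ s) ^ k * cost p q P (souzaCoeff m P s p c a) := by
          refine ENNReal.tsum_le_tsum fun k => (h.eLpNorm_layer_souza_le hp hs _ k).trans ?_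
          gcongr
          exact levelCost_le_cost hq P _ k
      _ < ∞ := by
          rw [ENNReal.tsum_mul_right, ENNReal.tsum_geometric]
          exact ENNReal.mul_lt_top
            (ENNReal.inv_lt_top.2 (tsub_pos_of_lt (h.rpow_lt_one hs))) hcost
  tendsto := by
    rw [← tendsto_add_atTop_iff_nat 1] at hlim ⊢
    -- The level costs need not be summable, only bounded by `L`, so their sum may grow linearly;
    -- the exponential factor absorbs it.
    have hdecay : Tendsto (fun N : ℕ => (θ ^ s) ^ N * (((N + 1 : ℕ) : ℝ≥0∞) * L)) atTop (𝓝 0) := by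
      have hr := tendsto_self_mul_const_pow_of_lt_one (r := (θ ^ s).toReal) ENNReal.toReal_nonneg
        (ENNReal.toReal_lt_of_lt_ofReal (by simpa using h.rpow_lt_one hs))
      have hr' := tendsto_pow_atTop_nhds_zero_of_lt_one (r := (θ ^ s).toReal)
        ENNReal.toReal_nonneg
        (ENNReal.toReal_lt_of_lt_ofReal (by simpa using h.rpow_lt_one hs))
      have := ENNReal.tendsto_ofReal ((hr.add hr').mul_const L.toReal)
      simp only [add_zero, zero_mul, ENNReal.ofReal_zero] at this
      refine this.congr fun N => ?_
      rw [show (N * (θ ^ s).toReal ^ N + (θ ^ s).toReal ^ N) * L.toReal =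
        (θ ^ s).toReal ^ N * (((N + 1 : ℕ) : ℝ) * L.toReal) by push_cast; ring,
        ENNReal.ofReal_mul (by positivity), ENNReal.ofReal_mul (by positivity),
        ENNReal.ofReal_pow ENNReal.toReal_nonneg, ENNReal.ofReal_toReal (h.rpow_lt_one hs).ne_top,
        ENNReal.ofReal_toReal hL, ENNReal.ofReal_natCast]
    have hsum := hlim.add hdecay
    rw [add_zero] at hsum
    refine tendsto_of_tendsto_of_tendsto_of_le_of_le tendsto_const_nhds hsum (fun _ => zero_le)
      fun N => ?_
    have hG := h.aestronglyMeasurable_partialSum hp hs hsβ hβp c ha (N + 1)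
    have hS : AEStronglyMeasurable
        (partialSum P (souzaCoeff m P s p c a) (souzaAtom m s p) (N + 1)) m :=
      (Finset.measurable_fun_sum _ fun k _ =>
        h.measurable_layer_souza s p _ k).aestronglyMeasurable
    have hsplit : (fun x => g x - partialSum P (souzaCoeff m P s p c a) (souzaAtom m s p) (N + 1) x) =
        (fun x => g x - partialSum P c a (N + 1) x) + fun x => partialSum P c a (N + 1) x -
          partialSum P (souzaCoeff m P s p c a) (souzaAtom m s p) (N + 1) x := by
      funext x
      simp
    change eLpNorm (fun x => g x -
      partialSum P (souzaCoeff m P s p c a) (souzaAtom m s p) (N + 1) x) _ m ≤ _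
    rw [hsplit]
    refine (eLpNorm_add_le (hg.sub hG) (hG.sub hS) (by simpa using hp)).trans ?_
    refine add_le_add le_rfl ?_
    refine (h.eLpNorm_partialSum_sub_le hp hs hsβ hβp c ha N).trans ?_
    gcongr
    calc ∑ j ∈ Finset.range (N + 1), levelCost p P c j ≤ ∑ j ∈ Finset.range (N + 1), L :=
          Finset.sum_le_sum fun j _ => hcL j
      _ = ((N + 1 : ℕ) : ℝ≥0∞) * L := by simp

end IsIntervalGrid

/-! ### Good grids, induced grids and comparison of atoms -/

theorem IsGoodGrid.isIntervalGrid {I : Set ℝ} (hI : I.OrdConnected) (hI1 : volume I = 1)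
    {P : ℕ → Finset (Set ℝ)} {c₁ c₂ : ℝ} (hP : IsGoodGrid (volume.restrict I) I P c₁ c₂)
    (hint : ∀ k, ∀ Q ∈ P k, Q.OrdConnected) :
    IsIntervalGrid (volume.restrict I) P (ENNReal.ofReal c₁) (ENNReal.ofReal c₂) := by
  have hc₂ : 0 < c₂ := hP.c₁_pos.trans hP.c₁_lt
  have : IsFiniteMeasure (volume.restrict I) := ⟨by simp [hI1]⟩
  have hreal : ∀ R, volume.restrict I R = ENNReal.ofReal ((volume.restrict I).real R) := fun R => by
    simp [measureReal_def]
  have hpos : ∀ k, ∀ R ∈ P k, 0 < (volume.restrict I).real R := fun k R hR =>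
    ENNReal.toReal_pos (hP.pos k R hR).ne' (measure_ne_top _ _)
  exact
  { ac := Measure.restrict_le_self.absolutelyContinuous
    le_one := by simp [hI1]
    κ_ne_zero := by simpa using hP.c₁_pos
    θ_lt_one := by simpa using hP.c₂_lt
    measurable := hP.measurable
    pos := hP.pos
    ordConnected := hint
    cover := fun k => by
      filter_upwards [ae_restrict_mem hI.measurableSet,
        measure_eq_zero_iff_ae_notMem.1 (hP.cover k)] with x hxI hx
      by_contra hne
      exact hx ⟨hxI, by simpa using hne⟩
    disjoint := hP.disjoint
    nested := hP.nested
    level_unique := fun i j Q hi hj => by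
      by_contra hij
      exact hP.ne i j hij Q hi Q hj rfl
    lower := fun k R hR Q hQ hQR => by
      rw [hreal, hreal Q, ← ENNReal.ofReal_mul hP.c₁_pos.le]
      exact ENNReal.ofReal_le_ofReal ((le_div_iff₀ (hpos k R hR)).1 (hP.ratio k R hR Q hQ hQR).1)
    upper := fun k R hR Q hQ hQR => by
      rw [hreal, hreal R, ← ENNReal.ofReal_mul hc₂.le]
      exact ENNReal.ofReal_le_ofReal ((div_le_iff₀ (hpos k R hR)).1 (hP.ratio k R hR Q hQ hQR).2) }

theorem mem_inducedGrid {P : ℕ → Finset (Set ℝ)} {k₀ i : ℕ} {Q R : Set ℝ} :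
    R ∈ inducedGrid P k₀ Q i ↔ R ∈ P (k₀ + i) ∧ R ⊆ Q := by
  simp [inducedGrid]

theorem souzaAtoms_subset_bvAtoms {m : Measure ℝ} {s β p : ℝ} (hβ : 0 < β) (Q : Set ℝ) :
    souzaAtoms m s p Q ⊆ bvAtoms m s β p Q := by
  rintro a ⟨h0, ⟨z, hz⟩, hb⟩
  refine ⟨h0, hb, ?_⟩
  rw [powerVar_eq_zero_of_const hβ fun x hx => hz x (interior_subset hx)]
  exact zero_le

/-- Changing the smoothness from `s` to `t` only changes the normalization of an atom. -/
theorem const_mul_mem_bvAtoms {m : Measure ℝ} {s t β p : ℝ} (hβ : 0 < β) {Q : Set ℝ}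
    (hQ : 0 < m.real Q) {a : ℝ → ℂ} (ha : a ∈ bvAtoms m s β p Q) :
    (fun x => ((m.real Q ^ (t - s) : ℝ) : ℂ) * a x) ∈ bvAtoms m t β p Q := by
  have hmul : ‖((m.real Q ^ (t - s) : ℝ) : ℂ)‖ₑ * ENNReal.ofReal (m.real Q ^ (s - 1 / p)) =
      ENNReal.ofReal (m.real Q ^ (t - 1 / p)) := by
    rw [← ofReal_norm, Complex.norm_real, Real.norm_of_nonneg (by positivity),
      ← ENNReal.ofReal_mul (by positivity), ← Real.rpow_add hQ]
    ring_nf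
  refine ⟨fun x hx => by simp [ha.1 x hx], ?_, ?_⟩
  · rw [← hmul]
    refine (eLpNorm_const_smul_le (c := ((m.real Q ^ (t - s) : ℝ) : ℂ)) (f := a)).trans ?_
    gcongr
    exact ha.2.1
  · rw [← hmul]
    refine (powerVar_const_mul_le hβ a _ _).trans ?_
    gcongr
    exact ha.2.2

theorem IsRepresentation.mono {Ω : Type*} [MeasurableSpace Ω] {m : Measure Ω}
    {P : ℕ → Finset (Set Ω)} {A B : Set Ω → Set (Ω → ℂ)} (hAB : ∀ Q, A Q ⊆ B Q) {p : ℝ} {q : ℝ≥0∞}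
    {g : Ω → ℂ} {c : Set Ω → ℂ} {a : Set Ω → Ω → ℂ} (h : IsRepresentation m P A p q g c a) :
    IsRepresentation m P B p q g c a :=
  { h with atom := fun k Q hQ => hAB Q (h.atom k Q hQ) }

theorem besovNorm_le_cost {Ω : Type*} [MeasurableSpace Ω] {m : Measure Ω}
    {P : ℕ → Finset (Set Ω)} {A : Set Ω → Set (Ω → ℂ)} {p : ℝ} {q : ℝ≥0∞}
    {g : Ω → ℂ} {c : Set Ω → ℂ} {a : Set Ω → Ω → ℂ} (h : IsRepresentation m P A p q g c a) :
    besovNorm m P A p q g ≤ cost p q P c :=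
  iInf₂_le_of_le c a (iInf_le _ h)

namespace IsIntervalGrid

variable {m : Measure ℝ} {P : ℕ → Finset (Set ℝ)} {κ θ : ℝ≥0∞}

theorem induced (h : IsIntervalGrid m P κ θ) {k₀ : ℕ} {Q : Set ℝ} (hQ : Q ∈ P k₀) :
    IsIntervalGrid (m.restrict Q) (inducedGrid P k₀ Q) κ θ where
  ac := Measure.restrict_le_self.absolutelyContinuous.trans h.ac
  le_one := (Measure.restrict_le_self _).trans h.le_one
  κ_ne_zero := h.κ_ne_zero
  θ_lt_one := h.θ_lt_one
  measurable k R hR := h.measurable _ R (mem_inducedGrid.1 hR).1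
  pos k R hR := by
    rw [Measure.restrict_eq_self _ (mem_inducedGrid.1 hR).2]
    exact h.pos _ R (mem_inducedGrid.1 hR).1
  ordConnected k R hR := h.ordConnected _ R (mem_inducedGrid.1 hR).1
  cover k := by
    filter_upwards [ae_restrict_mem (h.measurable _ Q hQ),
      ae_restrict_of_ae (h.cover (k₀ + k))] with x hxQ ⟨R, hR, hxR⟩
    exact ⟨R, mem_inducedGrid.2 ⟨hR, h.subset_of_mem (Nat.le_add_right k₀ k) hR hQ hxR hxQ⟩, hxR⟩
  disjoint k R hR R' hR' := h.disjoint _ R (mem_inducedGrid.1 hR).1 R' (mem_inducedGrid.1 hR').1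
  nested k R hR := by
    obtain ⟨hR, hRQ⟩ := mem_inducedGrid.1 hR
    obtain ⟨S, hS, hRS⟩ := h.nested (k₀ + k) R hR
    have hx := h.innerPt_mem hR
    exact ⟨S, mem_inducedGrid.2 ⟨hS, h.subset_of_mem (Nat.le_add_right k₀ k) hS hQ (hRS hx)
      (hRQ hx)⟩, hRS⟩
  level_unique i j R hi hj :=
    Nat.add_left_cancel (h.level_unique _ _ R (mem_inducedGrid.1 hi).1 (mem_inducedGrid.1 hj).1)
  lower k R hR S hS hSR := by
    rw [Measure.restrict_eq_self _ (mem_inducedGrid.1 hR).2,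
      Measure.restrict_eq_self _ (mem_inducedGrid.1 hS).2]
    exact h.lower _ R (mem_inducedGrid.1 hR).1 S (mem_inducedGrid.1 hS).1 hSR
  upper k R hR S hS hSR := by
    rw [Measure.restrict_eq_self _ (mem_inducedGrid.1 hR).2,
      Measure.restrict_eq_self _ (mem_inducedGrid.1 hS).2]
    exact h.upper _ R (mem_inducedGrid.1 hR).1 S (mem_inducedGrid.1 hS).1 hSR

theorem real_pos (h : IsIntervalGrid m P κ θ) {k : ℕ} {R : Set ℝ} (hR : R ∈ P k) : 0 < m.real R :=
  ENNReal.toReal_pos (h.pos k R hR).ne' (h.measure_ne_top R)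

theorem inducedGrid_zero (h : IsIntervalGrid m P κ θ) {k₀ : ℕ} {Q : Set ℝ} (hQ : Q ∈ P k₀) :
    inducedGrid P k₀ Q 0 = {Q} := by
  ext R
  rw [mem_inducedGrid, Finset.mem_singleton]
  constructor
  · rintro ⟨hR, hRQ⟩
    exact h.eq_of_mem hR hQ (h.innerPt_mem hR) (hRQ (h.innerPt_mem hR))
  · rintro rfl
    exact ⟨hQ, subset_rfl⟩

/-! ### Atoms of bounded variation as Besov atoms -/

/-- The atom is its own representation in the induced grid, with a single nonzero coefficient, so
the coefficient estimate leaves a pure geometric sequence of level costs. The hypothesis `hcost`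
isolates the only place where the cases `β = β'` and `β < β'` differ. -/
theorem mem_besovAtoms (h : IsIntervalGrid m P κ θ) {c₂ s β β' p : ℝ} (hp : 1 ≤ p) (hs : 0 < s)
    (hsβ : s ≤ β) (hββ' : β ≤ β') (hβp : β' ≤ 1 / p) {q A : ℝ≥0∞} (hq : 1 ≤ q) (hA : A ≠ ∞)
    (hcost : ∀ (P' : ℕ → Finset (Set ℝ)) (e : Set ℝ → ℂ) (D : ℝ≥0∞),
      (∀ k, levelCost p P' e k ≤ D * (θ ^ (β' - β)) ^ k) → cost p q P' e ≤ D * A)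
    {z : ℂ} (hz : (2 + κ⁻¹ ^ β') * A * ‖z‖ₑ ≤ (besovAtomConst P c₂ β p q)⁻¹)
    {k₀ : ℕ} {Q : Set ℝ} (hQ : Q ∈ P k₀) {b : ℝ → ℂ} (hb : b ∈ bvAtoms m s β' p Q) :
    (fun x => z * b x) ∈ besovAtoms m P c₂ s β p q Q := by
  classical
  have hp0 : 0 < p := by linarith
  have hβ0 : 0 < β := by linarith
  have hβ'0 : 0 < β' := by linarith
  set m' := m.restrict Q
  set P' := inducedGrid P k₀ Q with hP'
  have h' : IsIntervalGrid m' P' κ θ := h.induced hQ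
  have hQ' : Q ∈ P' 0 := mem_inducedGrid.2 ⟨hQ, subset_rfl⟩
  have hmQ : m' Q = m Q := Measure.restrict_eq_self _ subset_rfl
  have hmQr : m'.real Q = m.real Q := by rw [measureReal_def, hmQ, measureReal_def]
  have hQpos := h.real_pos hQ
  have hb' : b ∈ bvAtoms m' s β' p Q := by
    refine ⟨hb.1, ?_, ?_⟩
    · rw [hmQr]
      exact (eLpNorm_mono_measure b Measure.restrict_le_self).trans hb.2.1
    · rw [hmQr]
      exact hb.2.2
  -- The factor `m Q ^ (β - s)` makes `b` an atom of smoothness `β`; its inverse goes to the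
  -- coefficient and becomes the factor `|Q|^(s-β)` in the definition of Besov atoms.
  set c : Set ℝ → ℂ := fun R => if R = Q then z * ((m.real Q ^ (s - β) : ℝ) : ℂ) else 0 with hc
  set a : Set ℝ → ℝ → ℂ := fun R x =>
    if R = Q then ((m'.real Q ^ (β - s) : ℝ) : ℂ) * b x else 0 with ha_def
  have ha : AtomFamily m' P' β β' p a := by
    intro k R _
    by_cases hRQ : R = Q
    · subst hRQ
      simp only [ha_def, if_true]
      exact const_mul_mem_bvAtoms hβ'0 (hmQr ▸ hQpos) hb'
    · simp only [ha_def, if_neg hRQ]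
      exact souzaAtoms_subset_bvAtoms hβ'0 R ⟨fun _ _ => rfl, ⟨0, fun _ _ => rfl⟩, by
        rw [eLpNorm_zero']; exact zero_le⟩
  have hne : ∀ j, ∀ R ∈ P' (j + 1), R ≠ Q := by
    rintro j R hR rfl
    exact absurd (h'.level_unique _ _ _ hR hQ') (Nat.succ_ne_zero j)
  have hlayer0 : layer P' c a 0 = fun x => z * b x := by
    funext x
    rw [layer, hP', h.inducedGrid_zero hQ, Finset.sum_singleton]
    simp only [hc, ha_def, if_true]
    rw [hmQr, mul_assoc, ← mul_assoc (Complex.ofReal _), ← Complex.ofReal_mul,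
      ← Real.rpow_add hQpos]
    simp
  have hlayer : ∀ j, layer P' c a (j + 1) = 0 := fun j => by
    funext x
    rw [layer]
    exact Finset.sum_eq_zero fun R hR => by simp [hc, hne j R hR]
  have hpartial : ∀ N, partialSum P' c a (N + 1) = fun x => z * b x := fun N => by
    funext x
    rw [partialSum, Finset.sum_range_succ', hlayer0]
    simp [hlayer]
  have hlevel0 : levelCost p P' c 0 = ‖z‖ₑ * m Q ^ (s - β) := by
    rw [levelCost, hP', h.inducedGrid_zero hQ, Finset.sum_singleton, ← ENNReal.rpow_mul,
      mul_one_div_cancel hp0.ne', ENNReal.rpow_one]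
    simp only [hc, if_true]
    rw [enorm_mul, h.enorm_real_rpow hQ]
  have hlevel : ∀ j, levelCost p P' c (j + 1) = 0 := fun j => by
    rw [levelCost, Finset.sum_eq_zero fun R hR => by simp [hc, hne j R hR, hp0],
      ENNReal.zero_rpow_of_pos (by positivity)]
  have hmeas : AEStronglyMeasurable (fun x => z * b x) m' :=
    hlayer0 ▸ h'.aestronglyMeasurable_layer hp hβ0 hββ' hβp c ha 0
  have hbound : cost p q P' (souzaCoeff m' P' β p c a) ≤
      (2 + κ⁻¹ ^ β') * (‖z‖ₑ * m Q ^ (s - β)) * A := by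
    refine hcost _ _ _ fun k => (h'.levelCost_souzaCoeff_le hp hββ' hβ'0 hβp ha k).trans ?_
    rw [Finset.sum_range_succ', Finset.sum_eq_zero fun j _ => by rw [hlevel, mul_zero], hlevel0]
    refine le_of_eq ?_
    rw [zero_add, Nat.sub_zero]
    ring
  have hfin : m Q ^ (s - β) ≠ ∞ := by
    rw [← h.ofReal_rpow hQ]
    exact ENNReal.ofReal_ne_top
  have hκ : κ⁻¹ ^ β' ≠ ∞ :=
    ENNReal.rpow_ne_top_of_nonneg hβ'0.le (ENNReal.inv_ne_top.2 h.κ_ne_zero)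
  have hfin' : (2 + κ⁻¹ ^ β') * (‖z‖ₑ * m Q ^ (s - β)) * A < ∞ := by
    refine (ENNReal.mul_ne_top (ENNReal.mul_ne_top ?_ ?_) hA).lt_top
    · exact ENNReal.add_ne_top.2 ⟨by simp, hκ⟩
    · exact ENNReal.mul_ne_top enorm_ne_top hfin
  have hrep : IsRepresentation m' P' (souzaAtoms m' β p) p q (fun x => z * b x)
      (souzaCoeff m' P' β p c a) (souzaAtom m' β p) := by
    refine h'.isRepresentation_souza hp hβ0 hββ' hβp ha (L := ‖z‖ₑ * m Q ^ (s - β))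
      (ENNReal.mul_ne_top enorm_ne_top hfin) (fun k => ?_) hmeas ?_ hq (hbound.trans_lt hfin')
    · cases k with
      | zero => exact hlevel0.le
      | succ k => rw [hlevel]; exact zero_le
    · rw [← tendsto_add_atTop_iff_nat 1]
      simp [hpartial]
  refine ⟨fun x hx => by simp [hb.1 x hx], k₀, hQ, ⟨?_, _, _, hrep⟩, ?_⟩
  · have : IsFiniteMeasure m' := ⟨h'.le_one.trans_lt ENNReal.one_lt_top⟩
    have htop : MemLp (fun x => z * b x) ∞ m' := by
      refine ⟨hmeas, (eLpNorm_const_smul_le (c := z) (f := b)).trans_lt ?_⟩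
      exact ENNReal.mul_lt_top enorm_lt_top (hb'.2.1.trans_lt ENNReal.ofReal_lt_top)
    exact htop.mono_exponent le_top
  · refine (besovNorm_le_cost hrep).trans (hbound.trans ?_)
    rw [h.ofReal_rpow hQ]
    calc (2 + κ⁻¹ ^ β') * (‖z‖ₑ * m Q ^ (s - β)) * A
        = (2 + κ⁻¹ ^ β') * A * ‖z‖ₑ * m Q ^ (s - β) := by ring
      _ ≤ _ := by gcongr

/-- The `ℓ^q` norm of the geometric sequence is at most its `ℓ¹` norm, which gives a bound free of
`q`. -/
theorem besovAtomConst_le {P : ℕ → Finset (Set ℝ)} {c₂ β p : ℝ} (hc₂ : 0 < c₂)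
    {q : ℝ≥0∞} (hq : 1 ≤ q) :
    besovAtomConst P c₂ β p q ≤
      gridMult P ^ (1 + 1 / p) * (1 - ENNReal.ofReal c₂ ^ β)⁻¹ := by
  have hpow : ∀ k : ℕ, ENNReal.ofReal (c₂ ^ (k * β)) = (ENNReal.ofReal c₂ ^ β) ^ k := fun k => by
    rw [← ENNReal.ofReal_rpow_of_pos hc₂, mul_comm, ENNReal.rpow_mul, ENNReal.rpow_natCast]
  rw [besovAtomConst]
  gcongr
  split_ifs with hq'
  · refine iSup_le fun k => ?_
    rw [hpow, ← ENNReal.tsum_geometric]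
    exact ENNReal.le_tsum k
  · have h1 := one_le_toReal hq hq'
    rw [one_div, ENNReal.rpow_inv_le_iff (by linarith), ← ENNReal.tsum_geometric]
    refine le_trans (le_of_eq ?_) (tsum_rpow_le_rpow_tsum h1 _)
    refine tsum_congr fun k => ?_
    rw [← hpow, ENNReal.ofReal_rpow_of_pos (by positivity), ← Real.rpow_mul hc₂.le]

theorem exists_pos_mul_enorm_le_one {X : ℝ≥0∞} (hX : X ≠ ∞) :
    ∃ C : ℝ, 0 < C ∧ X * ‖(C : ℂ)‖ₑ ≤ 1 := by
  have hpos : 0 < 1 + X.toReal := by positivity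
  refine ⟨(1 + X.toReal)⁻¹, by positivity, ?_⟩
  rw [← ofReal_norm, Complex.norm_real, Real.norm_of_nonneg (by positivity)]
  nth_rewrite 1 [← ENNReal.ofReal_toReal hX]
  rw [← ENNReal.ofReal_mul ENNReal.toReal_nonneg, ENNReal.ofReal_le_one, ← div_eq_mul_inv,
    div_le_one hpos]
  linarith

/-- Up to a constant that does not depend on `q`, atoms of bounded variation are Besov atoms as
soon as the geometric sequence with ratio `c₂ ^ (β' - β)` has bounded cost. -/
theorem exists_const_mul_mem_besovAtoms {c₂ s β β' p : ℝ} (hc₂ : 0 < c₂)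
    (h : IsIntervalGrid m P κ (ENNReal.ofReal c₂)) (hmult : gridMult P < ∞) (hp : 1 ≤ p)
    (hs : 0 < s) (hsβ : s ≤ β) (hββ' : β ≤ β') (hβp : β' ≤ 1 / p) {A : ℝ≥0∞} (hA : A ≠ ∞)
    (S : Set ℝ≥0∞) (hS : ∀ q ∈ S, 1 ≤ q)
    (hcost : ∀ q ∈ S, ∀ (P' : ℕ → Finset (Set ℝ)) (e : Set ℝ → ℂ) (D : ℝ≥0∞),
      (∀ k, levelCost p P' e k ≤ D * (ENNReal.ofReal c₂ ^ (β' - β)) ^ k) →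
        cost p q P' e ≤ D * A) :
    ∃ C : ℝ, 0 < C ∧ ∀ q ∈ S, ∀ k, ∀ Q ∈ P k, ∀ b ∈ bvAtoms m s β' p Q,
      (fun x => (C : ℂ) * b x) ∈ besovAtoms m P c₂ s β p q Q := by
  have hβ0 : 0 < β := by linarith
  have hβ'0 : 0 < β' := by linarith
  have hκ : κ⁻¹ ^ β' ≠ ∞ :=
    ENNReal.rpow_ne_top_of_nonneg hβ'0.le (ENNReal.inv_ne_top.2 h.κ_ne_zero)
  set K := gridMult P ^ (1 + 1 / p) * (1 - ENNReal.ofReal c₂ ^ β)⁻¹ with hK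
  have hKtop : K ≠ ∞ := by
    refine ENNReal.mul_ne_top (ENNReal.rpow_ne_top_of_nonneg (by positivity) hmult.ne)
      (ENNReal.inv_ne_top.2 (tsub_pos_of_lt (h.rpow_lt_one hβ0)).ne')
  obtain ⟨C, hC, hle⟩ := exists_pos_mul_enorm_le_one
    (ENNReal.mul_ne_top (ENNReal.mul_ne_top (ENNReal.add_ne_top.2 ⟨by simp, hκ⟩) hA) hKtop :
      (2 + κ⁻¹ ^ β') * A * K ≠ ∞)
  refine ⟨C, hC, fun q hqS k Q hQ b hb => ?_⟩
  refine h.mem_besovAtoms hp hs hsβ hββ' hβp (hS q hqS) hA (hcost q hqS) ?_ hQ hb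
  refine le_trans ?_ (ENNReal.inv_le_inv.2 (besovAtomConst_le hc₂ (hS q hqS)))
  rw [ENNReal.le_inv_iff_mul_le]
  refine le_trans (le_of_eq ?_) hle
  rw [hK]
  ring

theorem cost_le_of_le_geometric {p : ℝ} {q : ℝ≥0∞} (hq : 1 ≤ q) {P : ℕ → Finset (Set ℝ)}
    {e : Set ℝ → ℂ} {D ρ : ℝ≥0∞} (hle : ∀ k, levelCost p P e k ≤ D * ρ ^ k) :
    cost p q P e ≤ D * (1 - ρ)⁻¹ := by
  rw [← ENNReal.tsum_geometric, ← ENNReal.tsum_mul_left]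
  exact (cost_le_tsum hq P e).trans (ENNReal.tsum_le_tsum hle)

/-- Strict inequality `s < β` makes the ratio `θ ^ (β - s)` less than one, so Young's inequality has
a finite constant. -/
theorem exists_souza_representation (h : IsIntervalGrid m P κ θ) {s β p : ℝ} (hp : 1 ≤ p)
    (hs : 0 < s) (hsβ : s < β) (hβp : β ≤ 1 / p) {q : ℝ≥0∞} (hq : 1 ≤ q) {g : ℝ → ℂ}
    (hg : MemLp g (ENNReal.ofReal p) m) {c : Set ℝ → ℂ} {a : Set ℝ → ℝ → ℂ}
    (hrep : IsRepresentation m P (bvAtoms m s β p) p q g c a) :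
    ∃ e b, IsRepresentation m P (souzaAtoms m s p) p q g e b ∧
      cost p q P e ≤ (2 + κ⁻¹ ^ β) * (1 - θ ^ (β - s))⁻¹ * cost p q P c := by
  have hβ : 0 < β := by linarith
  have hbound := cost_le_of_levelCost_le hq
    (h.levelCost_souzaCoeff_le hp hsβ.le hβ hβp (c := c) hrep.atom)
  have hκ : κ⁻¹ ^ β ≠ ∞ :=
    ENNReal.rpow_ne_top_of_nonneg hβ.le (ENNReal.inv_ne_top.2 h.κ_ne_zero)
  refine ⟨_, _, h.isRepresentation_souza hp hs hsβ.le hβp hrep.atom hrep.cost_lt.ne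
    (levelCost_le_cost hq P c) hg.1 hrep.tendsto hq (hbound.trans_lt ?_), hbound⟩
  refine ENNReal.mul_lt_top (ENNReal.mul_lt_top ?_ ?_) hrep.cost_lt
  · exact ENNReal.add_lt_top.2 ⟨by simp, hκ.lt_top⟩
  · exact ENNReal.inv_lt_top.2 (tsub_pos_of_lt (h.rpow_lt_one (sub_pos.2 hsβ)))

end IsIntervalGrid

end BesovGrid

end

/-! ### The proposition -/

open BesovGrid in
theorem proposition14p3 (I : Set ℝ) (hI : I.OrdConnected) (hI1 : volume I = 1)
    (m : Measure ℝ) (hm : m = volume.restrict I)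
    (P : ℕ → Finset (Set ℝ)) (c₁ c₂ : ℝ) (hP : IsGoodGrid m I P c₁ c₂)
    (hint : ∀ k, ∀ Q ∈ P k, Q.OrdConnected) (p : ℝ) (hp : 1 ≤ p) :
    (∀ s β : ℝ, 0 < s → s ≤ β → β ≤ 1 / p →
      ∃ C : ℝ, 0 < C ∧ ∀ k, ∀ Q ∈ P k, ∀ a ∈ bvAtoms m s β p Q,
        (fun x => (C : ℂ) * a x) ∈ besovAtoms m P c₂ s β p ∞ Q) ∧
    (∀ s β β' : ℝ, 0 < s → s ≤ β → β < β' → β' ≤ 1 / p →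
      ∃ C : ℝ, 0 < C ∧ ∀ q : ℝ≥0∞, 1 ≤ q → ∀ k, ∀ Q ∈ P k, ∀ a ∈ bvAtoms m s β' p Q,
        (fun x => (C : ℂ) * a x) ∈ besovAtoms m P c₂ s β p q Q) ∧
    (∀ s β : ℝ, 0 < s → s < β → β ≤ 1 / p → ∀ q : ℝ≥0∞, 1 ≤ q →
      besovSpace m P (souzaAtoms m s p) p q = besovSpace m P (bvAtoms m s β p) p q ∧
      ∃ C₁ C₂ : ℝ, 0 < C₁ ∧ 0 < C₂ ∧ ∀ f ∈ besovSpace m P (souzaAtoms m s p) p q,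
        besovNorm m P (bvAtoms m s β p) p q f ≤
          ENNReal.ofReal C₁ * besovNorm m P (souzaAtoms m s p) p q f ∧
        besovNorm m P (souzaAtoms m s p) p q f ≤
          ENNReal.ofReal C₂ * besovNorm m P (bvAtoms m s β p) p q f) := by
  subst hm
  have h := hP.isIntervalGrid hI hI1 hint
  have hc₂ : 0 < c₂ := hP.c₁_pos.trans hP.c₁_lt
  refine ⟨fun s β hs hsβ hβp => ?_, fun s β β' hs hsβ hββ' hβp => ?_,
    fun s β hs hsβ hβp q hq => ?_⟩
  -- With equal exponents the ratio is `1`: the level costs are only bounded, which suffices for the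
  -- supremum at `q = ∞`.
  · obtain ⟨C, hC, hmem⟩ := h.exists_const_mul_mem_besovAtoms hc₂ hP.mult hp hs hsβ le_rfl hβp
      (A := 1) ENNReal.one_ne_top {∞} (by simp) (by
        rintro q rfl P' e D hle
        rw [cost_top]
        refine iSup_le fun k => (hle k).trans ?_
        simp)
    exact ⟨C, hC, hmem ∞ rfl⟩
  · have hA : (1 - ENNReal.ofReal c₂ ^ (β' - β))⁻¹ ≠ ∞ :=
      ENNReal.inv_ne_top.2 (tsub_pos_of_lt (h.rpow_lt_one (sub_pos.2 hββ'))).ne'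
    exact h.exists_const_mul_mem_besovAtoms hc₂ hP.mult hp hs hsβ hββ'.le hβp hA
      (Set.Ici 1) (fun q hq => hq) fun q hq P' e D hle =>
        IsIntervalGrid.cost_le_of_le_geometric hq hle
  · have hβ : 0 < β := hs.trans hsβ
    have hmono : ∀ Q, souzaAtoms (volume.restrict I) s p Q ⊆ bvAtoms (volume.restrict I) s β p Q :=
      souzaAtoms_subset_bvAtoms hβ
    set D := (2 + (ENNReal.ofReal c₁)⁻¹ ^ β) * (1 - ENNReal.ofReal c₂ ^ (β - s))⁻¹ with hD
    have hDtop : D ≠ ∞ := by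
      refine ENNReal.mul_ne_top (ENNReal.add_ne_top.2 ⟨by simp, ?_⟩) ?_
      · exact ENNReal.rpow_ne_top_of_nonneg hβ.le (ENNReal.inv_ne_top.2 h.κ_ne_zero)
      · exact ENNReal.inv_ne_top.2 (tsub_pos_of_lt (h.rpow_lt_one (sub_pos.2 hsβ))).ne'
    have hD0 : D ≠ 0 := by
      refine mul_ne_zero (by simp) (ENNReal.inv_ne_zero.2 ?_)
      exact (tsub_le_self.trans_lt ENNReal.one_lt_top).ne
    refine ⟨Set.Subset.antisymm ?_ ?_, 1, D.toReal, one_pos, ENNReal.toReal_pos hD0 hDtop,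
      fun f hf => ⟨?_, ?_⟩⟩
    · rintro g ⟨hg, c, a, hrep⟩
      exact ⟨hg, c, a, hrep.mono hmono⟩
    · rintro g ⟨hg, c, a, hrep⟩
      obtain ⟨e, b, hrep', -⟩ := h.exists_souza_representation hp hs hsβ hβp hq hg hrep
      exact ⟨hg, e, b, hrep'⟩
    · rw [ENNReal.ofReal_one, one_mul]
      exact le_iInf fun c => le_iInf₂ fun a hrep => besovNorm_le_cost (hrep.mono hmono)
    -- As `D` is neither zero nor infinite it passes inside the infimum, so representations can be
    -- compared one at a time.
    · rw [ENNReal.ofReal_toReal hDtop, besovNorm, besovNorm]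
      simp only [ENNReal.mul_iInf_of_ne hD0 hDtop]
      refine le_iInf fun c => le_iInf₂ fun a hrep => ?_
      obtain ⟨e, b, hrep', hle⟩ := h.exists_souza_representation hp hs hsβ hβp hq hf.1 hrep
      exact (besovNorm_le_cost hrep').trans hle
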